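/- Let $\Lambda\subset\mathbb R^2$ satisfy $\inf_{x,y\in\Lambda,\,x\ne y}|x-y|>0$, and suppose that there are $m\ge 0$, $C\in\mathbb R$ and $\varepsilon\in(0,1)$ such that, for all $x\in\mathbb R^2$ and all $R>1$, $$\left|\#\bigl(B(x,R)\cap\Lambda\bigr)-m\pi R^2\right|\le C R^{1-\varepsilon}.$$ Then $W(\Lambda)<+\infty$ for this background $m$. Here $W(\Lambda)$ is the renormalized energy defined as follows. Let $\mathscr P_\Lambda$ be the set of vector fields $j\in L^1_{\mathrm{loc}}(\mathbb R^2,\mathbb R^2)\cap L^2_{\mathrm{loc}}(\mathbb R^2\setminus\Lambda,\mathbb R^2)$ such that, in the sense of distributions on $\mathbb R^2$, $$-\operatorname{div} j=2\pi\Bigl(\sum_{p\in\Lambda}\delta_p-m\Bigr)\quad\text{and}\quad \operatorname{curl} j=0$$ (so that $j$ is a gradient). Let $(\chi_R)_{R>1}$ be any family of smooth functions on $\mathbb R^2$ with $\chi_R\ge 0$, $\chi_R=1$ on $B(0,R-1)$, $\chi_R=0$ outside $B(0,R)$, and $\|\nabla\chi_R\|_\infty$ bounded independently of $R$. Put $$W(j,\chi_R)=\limsup_{\eta\to0^+}\left(\frac12\int_{\mathbb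 R^2\setminus\bigcup_{p\in\Lambda}B(p,\eta)}\chi_R|j|^2+\pi\log\eta\sum_{p\in\Lambda}\chi_R(p)\right),$$ $$W(j)=\limsup_{R\to\infty}\frac{W(j,\chi_R)}{|B(0,R)|},\qquad W(\Lambda)=\inf_{j\in\mathscr P_\Lambda}W(j),$$ with $\inf\varnothing=+\infty$. The conclusion holds for every such family $(\chi_R)$. -/

import Mathlib

open MeasureTheory Filter Topology Set
open scoped ContDiff ENNReal

/-- The Euclidean plane. -/
abbrev Plane : Type := EuclideanSpace ℝ (Fin 2)

/-- `inf_{x ≠ y ∈ Λ} |x - y| > 0`, the infimum over an empty family being `+∞`. -/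
def UniformlySeparated (Λ : Set Plane) : Prop :=
  0 < Λ.einfsep

/-- `j ∈ L²_loc(ℝ² \ Λ, ℝ²)`: square integrable on each compact subset of `ℝ² \ Λ`. -/
def L2LocOff (Λ : Set Plane) (j : Plane → Plane) : Prop :=
  ∀ K : Set Plane, IsCompact K → K ⊆ Λᶜ → MemLp j 2 (volume.restrict K)

/-- `-div j = 2π (∑_{p ∈ Λ} δ_p - m)` in the sense of distributions on the whole plane; the locally
integrable field `j` is tested against every smooth compactly supported function `φ`.
Here `fderiv ℝ φ x (j x)` is `∇φ(x) · j(x)`. -/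
def SolvesDivEquation (Λ : Set Plane) (m : ℝ) (j : Plane → Plane) : Prop :=
  LocallyIntegrable j volume ∧
    ∀ φ : Plane → ℝ, ContDiff ℝ ∞ φ → HasCompactSupport φ →
      ∫ x, fderiv ℝ φ x (j x) = 2 * Real.pi * ((∑ᶠ p ∈ Λ, φ p) - m * ∫ x, φ x)

/-- `curl j = ∂₁ j₂ - ∂₂ j₁ = 0` in the sense of distributions on the whole plane. -/
def IsCurlFree (j : Plane → Plane) : Prop :=
  ∀ φ : Plane → ℝ, ContDiff ℝ ∞ φ → HasCompactSupport φ →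
    ∫ x, (fderiv ℝ φ x (EuclideanSpace.single 0 1) * j x 1
      - fderiv ℝ φ x (EuclideanSpace.single 1 1) * j x 0) = 0

/-- The class `𝓕_Λ` of admissible vector fields for the background `m`. -/
def admissibleFields (Λ : Set Plane) (m : ℝ) : Set (Plane → Plane) :=
  {j | L2LocOff Λ j ∧ SolvesDivEquation Λ m j}

/-- The class `𝓟_Λ` of the curl-free admissible vector fields (the gradients in `𝓕_Λ`). -/
def admissibleGradients (Λ : Set Plane) (m : ℝ) : Set (Plane → Plane) :=
  {j | j ∈ admissibleFields Λ m ∧ IsCurlFree j}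

/-- A family `(χ_R)_{R > 1}` of smooth cutoffs: `χ_R ≥ 0`, `|∇χ_R| ≤ C` with `C` independent of
`R`, `χ_R = 1` on `B_{R-1}`, and `χ_R = 0` outside `B_R`. -/
def IsCutoffFamily (χ : ℝ → Plane → ℝ) : Prop :=
  ∃ C : ℝ, ∀ R : ℝ, 1 < R →
    ContDiff ℝ ∞ (χ R) ∧ (∀ x, 0 ≤ χ R x) ∧ (∀ x, ‖fderiv ℝ (χ R) x‖ ≤ C) ∧
    (∀ x ∈ Metric.ball (0 : Plane) (R - 1), χ R x = 1) ∧
    (∀ x ∉ Metric.ball (0 : Plane) R, χ R x = 0)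

/-- `W(j, χ) = limsup_{η → 0}
  (½ ∫_{ℝ² \ ⋃_{p ∈ Λ} B(p, η)} χ |j|² + π log η ∑_{p ∈ Λ} χ(p))`. -/
noncomputable def truncatedEnergy (Λ : Set Plane) (j : Plane → Plane) (χ : Plane → ℝ) : EReal :=
  limsup (fun η : ℝ =>
    ((∫⁻ x in (⋃ p ∈ Λ, Metric.ball p η)ᶜ, ENNReal.ofReal (1 / 2 * (χ x * ‖j x‖ ^ 2)) : ℝ≥0∞) :
        EReal)
      + ((Real.pi * Real.log η * ∑ᶠ p ∈ Λ, χ p : ℝ) : EReal)) (𝓝[>] (0 : ℝ))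

/-- `W(j) = limsup_{R → ∞} W(j, χ_R) / |B_R|`. -/
noncomputable def fieldEnergy (χ : ℝ → Plane → ℝ) (Λ : Set Plane) (j : Plane → Plane) : EReal :=
  limsup (fun R : ℝ =>
    truncatedEnergy Λ j (χ R) / ((volume.real (Metric.ball (0 : Plane) R) : ℝ) : EReal)) atTop

/-- The renormalized energy `W(Λ)` for the background `m`: the infimum of `W(j)` over the gradients
`j ∈ 𝓟_Λ`, which is `+∞` when there is none. -/
noncomputable def renormalizedEnergy (χ : ℝ → Plane → ℝ) (Λ : Set Plane) (m : ℝ) : EReal :=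
  ⨅ j ∈ admissibleGradients Λ m, fieldEnergy χ Λ j

/-! It suffices to exhibit one admissible gradient of finite energy per unit area. Choose `r` at
most half the separation and write `j = -(pointField Λ r + g)`. The first summand is a sum of
explicit radial gradients supported in disjoint discs: each behaves like `y / ‖y‖²` at its point,
and its divergence is that of the point charge minus the same charge spread uniformly over the disc.
It remains to solve `div g = 2π f` with `g` bounded and curl-free, where `f = smearedDensity Λ r m`.

The counting hypothesis says that the means of `f` over balls of radius `R` are `O(R ^ (-(1 + ε)))`
(`ballMean_smearedDensity`). Convolving a density with `screenedKernel R` solves the equation for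
that density minus its mean over `R`-balls, by a field of size at most `2πR` times its supremum.
Averaging `f` successively at the radii `2, 4, 8, …` and solving for each difference gives a
telescoping series whose `k`-th field is `O(2 ^ (-ε k))`; it converges to a bounded `g`
(`exists_bounded_field`). The gain `ε` over the exponent `1` is exactly what makes it summable.

For the energy (`truncatedEnergy_le`), the disc around `p` contributes `π χ(p) log (r / η)` up to
bounded errors, and the term `π χ(p) log η` cancels the divergence. What is left is `O(1)` per point
and `O(R²)` from `g`, while `B_R` contains `O(R²)` points. -/

/-! ### Polar coordinates on the plane -/

/-- The point of the unit circle with argument `θ`. -/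
noncomputable def circlePoint (θ : ℝ) : Plane :=
  Real.cos θ • EuclideanSpace.single 0 1 + Real.sin θ • EuclideanSpace.single 1 1

/-- The derivative of `circlePoint`. -/
noncomputable def circleTangent (θ : ℝ) : Plane :=
  -Real.sin θ • EuclideanSpace.single 0 1 + Real.cos θ • EuclideanSpace.single 1 1

lemma hasDerivAt_circlePoint (θ : ℝ) : HasDerivAt circlePoint (circleTangent θ) θ :=
  ((Real.hasDerivAt_cos θ).smul_const _).add ((Real.hasDerivAt_sin θ).smul_const _)

lemma continuous_circlePoint : Continuous circlePoint := by
  unfold circlePoint; fun_prop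

lemma continuous_circleTangent : Continuous circleTangent := by
  unfold circleTangent; fun_prop

lemma norm_circlePoint (θ : ℝ) : ‖circlePoint θ‖ = 1 := by
  simp [circlePoint, EuclideanSpace.norm_eq, Fin.sum_univ_two]

lemma integral_plane_eq_polar (f : Plane → ℝ) :
    ∫ x, f x = ∫ p in polarCoord.target, p.1 * f (p.1 • circlePoint p.2) := by
  have h1 := (EuclideanSpace.volume_preserving_symm_measurableEquiv_toLp (Fin 2)).symm
  have h2 := (volume_preserving_finTwoArrow ℝ).symm
  rw [← h1.integral_comp', ← h2.integral_comp', ← integral_comp_polarCoord_symm]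
  refine setIntegral_congr_fun polarCoord.open_target.measurableSet fun p _ => ?_
  simp only [smul_eq_mul]
  congr 2
  ext i
  fin_cases i <;> simp [circlePoint, polarCoord_symm_apply]

/-- The Jacobian `s` is absorbed into `G`: for the kernels below it cancels the singularity at the
origin, so `G` can be taken continuous on the whole rectangle. -/
lemma integral_plane_eq_setIntegral_of_polar {f : Plane → ℝ} {G : ℝ × ℝ → ℝ} {r : ℝ}
    (hfG : ∀ s θ, 0 < s → s < r → s * f (s • circlePoint θ) = G (s, θ))
    (hf : ∀ x, r ≤ ‖x‖ → f x = 0) :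
    ∫ x, f x = ∫ p in Ioo 0 r ×ˢ Ioo (-Real.pi) Real.pi, G p := by
  rw [integral_plane_eq_polar]
  have hsub : Ioo 0 r ×ˢ Ioo (-Real.pi) Real.pi ⊆ polarCoord.target := by
    rw [polarCoord_target]
    exact prod_mono Ioo_subset_Ioi_self le_rfl
  rw [setIntegral_eq_of_subset_of_forall_sdiff_eq_zero
    polarCoord.open_target.measurableSet hsub]
  · refine setIntegral_congr_fun (measurableSet_Ioo.prod measurableSet_Ioo) fun p hp => ?_
    exact hfG p.1 p.2 hp.1.1 hp.1.2
  · intro p hp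
    rw [polarCoord_target] at hp
    have h0 : 0 < p.1 := hp.1.1
    have : r ≤ p.1 := by
      by_contra! h
      exact hp.2 ⟨⟨h0, h⟩, hp.1.2⟩
    rw [hf _ (by simpa [norm_smul, norm_circlePoint, abs_of_pos h0] using this), mul_zero]

lemma Continuous.integrableOn_Ioo_prod_Ioo {G : ℝ × ℝ → ℝ} (hG : Continuous G) (a b c d : ℝ) :
    IntegrableOn G (Ioo a b ×ˢ Ioo c d) :=
  (hG.continuousOn.integrableOn_compact (isCompact_Icc.prod isCompact_Icc)).mono_set
    (prod_mono Ioo_subset_Icc_self Ioo_subset_Icc_self)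

/-! ### The screened Coulomb kernel -/

/-- Minus the field generated by a unit charge screened by the uniform charge on the disc of
radius `r` around it. -/
noncomputable def screenedKernel (r : ℝ) (y : Plane) : Plane :=
  -- The coefficient vanishes at `‖y‖ = r`, so truncating there puts no charge on the circle.
  max ((‖y‖ ^ 2)⁻¹ - (r ^ 2)⁻¹) 0 • y

/-- The mean of `f` over the ball of radius `r` around `x`. -/
noncomputable def ballMean (r : ℝ) (f : Plane → ℝ) (x : Plane) : ℝ :=
  (Real.pi * r ^ 2)⁻¹ * ∫ y in Metric.ball (0 : Plane) r, f (x + y)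

/-- Rotation by a quarter turn, clockwise. -/
noncomputable def quarterTurn : Plane →L[ℝ] Plane :=
  LinearMap.toContinuousLinearMap
    { toFun := fun v => v 1 • EuclideanSpace.single 0 1 - v 0 • EuclideanSpace.single 1 1
      map_add' := fun v w => by simp only [PiLp.add_apply, add_smul]; abel
      map_smul' := fun c v => by simp [smul_sub, mul_smul] }

lemma quarterTurn_apply (v : Plane) :
    quarterTurn v = v 1 • EuclideanSpace.single 0 1 - v 0 • EuclideanSpace.single 1 1 := rfl

/-- Testing the curl of `j` amounts to testing the divergence of `quarterTurn ∘ j`, so both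
equations become one pairing with a linear map `T`. A radial field turns into a tangential one. -/
lemma quarterTurn_circlePoint (θ : ℝ) : quarterTurn (circlePoint θ) = -circleTangent θ := by
  rw [quarterTurn_apply]
  ext i
  fin_cases i <;> simp [circlePoint, circleTangent]

lemma measurable_screenedKernel (r : ℝ) : Measurable (screenedKernel r) := by
  unfold screenedKernel; fun_prop

lemma screenedKernel_eq_zero {r : ℝ} (hr : 0 < r) {y : Plane} (hy : r ≤ ‖y‖) :
    screenedKernel r y = 0 := by
  have : (‖y‖ ^ 2)⁻¹ ≤ (r ^ 2)⁻¹ := by gcongr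
  rw [screenedKernel, max_eq_right (by linarith), zero_smul]

lemma norm_screenedKernel_le (r : ℝ) (y : Plane) : ‖screenedKernel r y‖ ≤ ‖y‖⁻¹ := by
  rcases eq_or_ne y 0 with rfl | hy
  · simp [screenedKernel]
  have hy' : 0 < ‖y‖ := norm_pos_iff.2 hy
  rw [screenedKernel, norm_smul, Real.norm_of_nonneg (le_max_right _ _)]
  calc max ((‖y‖ ^ 2)⁻¹ - (r ^ 2)⁻¹) 0 * ‖y‖ ≤ (‖y‖ ^ 2)⁻¹ * ‖y‖ := by
        gcongr
        exact max_le (by have : 0 ≤ (r ^ 2)⁻¹ := by positivity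
                         linarith) (by positivity)
    _ = ‖y‖⁻¹ := by field_simp

lemma screenedKernel_polar {r s : ℝ} (hs : 0 < s) (hsr : s < r) (θ : ℝ) :
    s • screenedKernel r (s • circlePoint θ) = (1 - s ^ 2 / r ^ 2) • circlePoint θ := by
  have hr : 0 < r := hs.trans hsr
  have h1 : (r ^ 2)⁻¹ ≤ (s ^ 2)⁻¹ := by gcongr
  have h2 : ‖s • circlePoint θ‖ = s := by
    rw [norm_smul, norm_circlePoint, mul_one, Real.norm_of_nonneg hs.le]
  rw [screenedKernel, h2, max_eq_left (by linarith), smul_smul, smul_smul]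
  congr 1
  field_simp

lemma integrableOn_inv_norm (r : ℝ) :
    IntegrableOn (fun y : Plane => ‖y‖⁻¹) (Metric.ball 0 r) := by
  rw [integrableOn_fun_norm_addHaar volume (f := fun s : ℝ => s⁻¹)]
  refine (integrableOn_const (C := (1 : ℝ)) (by simp)).congr_fun (s := Ioo 0 r)
    (fun s hs => ?_) measurableSet_Ioo
  simp [hs.1.ne']

lemma integral_radial_indicator (f : ℝ → ℝ) {S : Set ℝ} (hS : MeasurableSet S)
    (hS0 : S ⊆ Ioi 0) :
    ∫ x : Plane, S.indicator f ‖x‖ = 2 * Real.pi * ∫ s in S, s * f s := by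
  rw [integral_fun_norm_addHaar volume (S.indicator f)]
  have : volume.real (Metric.ball (0 : Plane) 1) = Real.pi := by
    simp [Measure.real, EuclideanSpace.volume_ball_fin_two, Real.pi_pos.le]
  simp only [finrank_euclideanSpace, Fintype.card_fin, this, smul_eq_mul, nsmul_eq_mul,
    Nat.add_one_sub_one, pow_one]
  have h2 : (fun y : ℝ => y * S.indicator f y) = S.indicator fun y => y * f y := by
    ext y; by_cases hy : y ∈ S <;> simp [hy]
  rw [h2, setIntegral_indicator hS, inter_eq_right.2 hS0]
  push_cast; ring

lemma integral_inv_norm_ball {r : ℝ} (hr : 0 < r) :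
    ∫ y in Metric.ball (0 : Plane) r, ‖y‖⁻¹ = 2 * Real.pi * r := by
  have h := integral_radial_indicator (fun s : ℝ => s⁻¹) (S := Ioo 0 r) measurableSet_Ioo
    Ioo_subset_Ioi_self
  rw [setIntegral_congr_fun (g := fun _ => (1 : ℝ)) measurableSet_Ioo
    (fun s hs => mul_inv_cancel₀ hs.1.ne')] at h
  simp only [integral_const, MeasurableSet.univ, measureReal_restrict_apply, univ_inter,
    Real.volume_real_Ioo, smul_eq_mul, mul_one, sub_zero, max_eq_left hr.le] at h
  rw [← h, ← integral_indicator measurableSet_ball]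
  refine integral_congr_ae (Eventually.of_forall fun x => ?_)
  rcases eq_or_ne x 0 with rfl | hx
  · simp [indicator]
  · simp [indicator, hx]

lemma norm_screenedKernel_le_indicator {r : ℝ} (hr : 0 < r) (y : Plane) :
    ‖screenedKernel r y‖ ≤ (Metric.ball (0 : Plane) r).indicator (fun y => ‖y‖⁻¹) y := by
  by_cases hy : y ∈ Metric.ball (0 : Plane) r
  · rw [indicator_of_mem hy]; exact norm_screenedKernel_le r y
  · rw [screenedKernel_eq_zero hr (by simpa using hy), indicator_of_notMem hy, norm_zero]

lemma integrable_screenedKernel {r : ℝ} (hr : 0 < r) : Integrable (screenedKernel r) :=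
  ((integrableOn_inv_norm r).integrable_indicator measurableSet_ball).mono'
    (measurable_screenedKernel r).aestronglyMeasurable
    (Eventually.of_forall (norm_screenedKernel_le_indicator hr))

/-- This linear growth in `r` is what the decay of the ball means has to beat. -/
lemma integral_norm_screenedKernel_le {r : ℝ} (hr : 0 < r) :
    ∫ y, ‖screenedKernel r y‖ ≤ 2 * Real.pi * r := by
  rw [← integral_inv_norm_ball hr, ← integral_indicator measurableSet_ball]
  exact integral_mono (integrable_screenedKernel hr).norm
    ((integrableOn_inv_norm r).integrable_indicator measurableSet_ball)
    (norm_screenedKernel_le_indicator hr)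

lemma continuous_circlePoint_smul : Continuous fun p : ℝ × ℝ => p.1 • circlePoint p.2 :=
  continuous_fst.smul (continuous_circlePoint.comp continuous_snd)

lemma measurable_fderiv_apply {φ : Plane → ℝ} (hφ : Continuous (fderiv ℝ φ))
    {α : Type*} [MeasurableSpace α] {u v : α → Plane} (hu : Measurable u) (hv : Measurable v) :
    Measurable fun x => fderiv ℝ φ (u x) (v x) := by
  have h : Continuous fun q : Plane × Plane => fderiv ℝ φ q.1 q.2 :=
    (hφ.comp continuous_fst).clm_apply continuous_snd
  exact h.measurable.comp (hu.prodMk hv)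

/-- Integration by parts along each ray: the weight `1 - s ^ 2 / r ^ 2` is `1` at the charge and `0`
at the edge of the disc, and its derivative produces the uniform screening charge. -/
lemma integral_fderiv_screenedKernel_zero {φ : Plane → ℝ} (hφ : ContDiff ℝ ∞ φ)
    (hφc : HasCompactSupport φ) {r : ℝ} (hr : 0 < r) :
    ∫ x, fderiv ℝ φ x (screenedKernel r x) = -(2 * Real.pi) * (φ 0 - ballMean r φ 0) := by
  have hcont : Continuous (fderiv ℝ φ) := hφ.continuous_fderiv (by simp)
  have hb : ∃ B, ∀ x, ‖fderiv ℝ φ x‖ ≤ B :=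
    (hφc.fderiv ℝ).exists_bound_of_continuous hcont
  obtain ⟨B, hB⟩ := hb
  have hint1 : Integrable fun x => fderiv ℝ φ x (screenedKernel r x) := by
    refine ((integrable_screenedKernel hr).norm.const_mul B).mono' ?_
      (Eventually.of_forall fun x => ?_)
    · exact (measurable_fderiv_apply hcont measurable_id (measurable_screenedKernel r)).aestronglyMeasurable
    · exact (ContinuousLinearMap.le_opNorm _ _).trans (by gcongr; exact hB x)
  have hint2 : Integrable ((Metric.ball (0 : Plane) r).indicator fun x => 2 / r ^ 2 * φ x) :=
    ((hφ.continuous.integrable_of_hasCompactSupport hφc).const_mul _).indicator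
      measurableSet_ball
  -- With the screening term included, the integrand on each ray is the exact derivative of `(1 - s
  -- ^ 2 / r ^ 2) * φ (s • circlePoint θ)`.
  have key : ∫ x, (fderiv ℝ φ x (screenedKernel r x)
      - (Metric.ball (0 : Plane) r).indicator (fun x => 2 / r ^ 2 * φ x) x)
      = -(2 * Real.pi) * φ 0 := by
    set G : ℝ × ℝ → ℝ := fun p =>
      (1 - p.1 ^ 2 / r ^ 2) * fderiv ℝ φ (p.1 • circlePoint p.2) (circlePoint p.2)
        - 2 * p.1 / r ^ 2 * φ (p.1 • circlePoint p.2) with hG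
    have hGc : Continuous G := by
      have h1 := continuous_circlePoint_smul
      have h2 : Continuous fun p : ℝ × ℝ => circlePoint p.2 :=
        continuous_circlePoint.comp continuous_snd
      have h3 : Continuous fun p : ℝ × ℝ =>
          fderiv ℝ φ (p.1 • circlePoint p.2) (circlePoint p.2) :=
        (hcont.comp h1).clm_apply h2
      have h4 : Continuous fun p : ℝ × ℝ => φ (p.1 • circlePoint p.2) := hφ.continuous.comp h1
      fun_prop
    rw [integral_plane_eq_setIntegral_of_polar (G := G) (r := r)]
    · rw [Measure.volume_eq_prod, ← setIntegral_prod_swap, setIntegral_prod]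
      · have hinner : ∀ θ : ℝ, ∫ s in Ioo 0 r, G (s, θ) = -φ 0 := by
          intro θ
          rw [← integral_Ioc_eq_integral_Ioo, ← intervalIntegral.integral_of_le hr.le]
          rw [intervalIntegral.integral_eq_sub_of_hasDerivAt
            (f := fun s => (1 - s ^ 2 / r ^ 2) * φ (s • circlePoint θ))]
          · simp [hr.ne']
          · intro s _
            have hφd : HasDerivAt (fun s : ℝ => φ (s • circlePoint θ))
                (fderiv ℝ φ (s • circlePoint θ) (circlePoint θ)) s := by
              have h1 := (hφ.differentiable (by simp) (s • circlePoint θ)).hasFDerivAt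
              have h2 : HasDerivAt (fun s : ℝ => s • circlePoint θ) (circlePoint θ) s := by
                simpa using (hasDerivAt_id s).smul_const (circlePoint θ)
              exact h1.comp_hasDerivAt s h2
            have hp : HasDerivAt (fun s : ℝ => 1 - s ^ 2 / r ^ 2) (-(2 * s / r ^ 2)) s := by
              simpa using ((hasDerivAt_pow 2 s).div_const (r ^ 2)).const_sub 1
            refine (hp.mul hφd).congr_deriv ?_
            simp only [hG]; ring
          · exact (hGc.comp (continuous_id.prodMk continuous_const)).intervalIntegrable _ _
        simp only [Prod.swap_prod_mk, hinner]
        rw [setIntegral_const, Real.volume_real_Ioo_of_le (by linarith [Real.pi_pos]),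
          smul_eq_mul]
        ring
      · exact (hGc.comp continuous_swap).integrableOn_Ioo_prod_Ioo _ _ _ _
    · intro s θ hs hsr
      have hmem : s • circlePoint θ ∈ Metric.ball (0 : Plane) r := by
        simp [norm_smul, norm_circlePoint, abs_of_pos hs, hsr]
      rw [indicator_of_mem hmem, mul_sub, ← smul_eq_mul, ← map_smul,
        screenedKernel_polar hs hsr, map_smul, hG]
      simp only [smul_eq_mul]
      ring
    · intro x hx
      rw [screenedKernel_eq_zero hr hx, map_zero, indicator_of_notMem (by simpa using hx),
        sub_zero]
  rw [integral_sub hint1 hint2, integral_indicator measurableSet_ball,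
    integral_const_mul] at key
  simp only [ballMean, zero_add]
  have hpi := Real.pi_pos
  field_simp at key ⊢
  linarith

/-- The turned field is tangential with radial weight, so on each circle the integrand is the
derivative of a periodic function of `θ`. -/
lemma integral_fderiv_quarterTurn_screenedKernel_zero {φ : Plane → ℝ} (hφ : ContDiff ℝ ∞ φ)
    {r : ℝ} (hr : 0 < r) :
    ∫ x, fderiv ℝ φ x (quarterTurn (screenedKernel r x)) = 0 := by
  have hcont : Continuous (fderiv ℝ φ) := hφ.continuous_fderiv (by simp)
  set G : ℝ × ℝ → ℝ := fun p =>
      -((1 - p.1 ^ 2 / r ^ 2) * fderiv ℝ φ (p.1 • circlePoint p.2) (circleTangent p.2)) with hG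
  have hGc : Continuous G := by
    have h1 := continuous_circlePoint_smul
    have h2 : Continuous fun p : ℝ × ℝ => circleTangent p.2 :=
      continuous_circleTangent.comp continuous_snd
    have h3 : Continuous fun p : ℝ × ℝ =>
        fderiv ℝ φ (p.1 • circlePoint p.2) (circleTangent p.2) :=
      (hcont.comp h1).clm_apply h2
    fun_prop
  rw [integral_plane_eq_setIntegral_of_polar (G := G) (r := r)]
  · rw [Measure.volume_eq_prod, setIntegral_prod _ (hGc.integrableOn_Ioo_prod_Ioo _ _ _ _)]
    refine (setIntegral_congr_fun (g := fun _ => (0 : ℝ)) measurableSet_Ioo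
      fun s hs => ?_).trans (by simp)
    have hs0 : s ≠ 0 := hs.1.ne'
    have hd : ∀ θ : ℝ, HasDerivAt
        (fun θ => -((1 - s ^ 2 / r ^ 2) * (s⁻¹ * φ (s • circlePoint θ)))) (G (s, θ)) θ := by
      intro θ
      have h1 := (hφ.differentiable (by simp) (s • circlePoint θ)).hasFDerivAt
      have h2 := h1.comp_hasDerivAt θ ((hasDerivAt_circlePoint θ).const_smul s)
      refine ((h2.const_mul s⁻¹).const_mul (1 - s ^ 2 / r ^ 2)).neg.congr_deriv ?_
      rw [map_smul, smul_eq_mul, inv_mul_cancel_left₀ hs0]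
    change ∫ θ in Ioo (-Real.pi) Real.pi, G (s, θ) = 0
    rw [← integral_Ioc_eq_integral_Ioo,
      ← intervalIntegral.integral_of_le (by linarith [Real.pi_pos]),
      intervalIntegral.integral_eq_sub_of_hasDerivAt (fun θ _ => hd θ)
        ((hGc.comp (continuous_const.prodMk continuous_id)).intervalIntegrable _ _)]
    simp [circlePoint]
  · intro s θ hs hsr
    rw [← smul_eq_mul, ← map_smul, ← map_smul, screenedKernel_polar hs hsr, map_smul,
      quarterTurn_circlePoint, hG, map_smul, map_neg, smul_eq_mul, mul_neg]
  · intro x hx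
    rw [screenedKernel_eq_zero hr hx, map_zero, map_zero]

/-- The distributional identity `div (T K_r) = -c (δ - 1_{B_r} / |B_r|)` for the screened kernels
`K_r` of all radii and their translates. -/
def KernelPairing (T : Plane →L[ℝ] Plane) (c : ℝ) : Prop :=
  ∀ φ : Plane → ℝ, ContDiff ℝ ∞ φ → HasCompactSupport φ → ∀ r : ℝ, 0 < r → ∀ y : Plane,
    ∫ x, fderiv ℝ φ x (T (screenedKernel r (x - y))) = c * (φ y - ballMean r φ y)

lemma kernelPairing_of_zero {T : Plane →L[ℝ] Plane} {c : ℝ}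
    (h : ∀ φ : Plane → ℝ, ContDiff ℝ ∞ φ → HasCompactSupport φ → ∀ r : ℝ, 0 < r →
      ∫ x, fderiv ℝ φ x (T (screenedKernel r x)) = c * (φ 0 - ballMean r φ 0)) :
    KernelPairing T c := by
  intro φ hφ hφc r hr y
  have h1 := h (fun x => φ (x + y)) (hφ.comp (contDiff_id.add contDiff_const))
    (hφc.comp_homeomorph (Homeomorph.addRight y)) r hr
  simp only [fderiv_comp_add_right, ballMean, zero_add] at h1
  rw [← integral_sub_right_eq_self _ y] at h1
  simp only [sub_add_cancel] at h1
  rw [h1]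
  simp only [ballMean, add_comm]

lemma kernelPairing_id : KernelPairing (ContinuousLinearMap.id ℝ Plane) (-(2 * Real.pi)) :=
  kernelPairing_of_zero fun _ hφ hφc _ hr => integral_fderiv_screenedKernel_zero hφ hφc hr

lemma kernelPairing_quarterTurn : KernelPairing quarterTurn 0 :=
  kernelPairing_of_zero fun _ hφ _ _ hr => by
    rw [integral_fderiv_quarterTurn_screenedKernel_zero hφ hr, zero_mul]

/-! ### Means over balls -/

lemma measurable_ballMean (r : ℝ) {f : Plane → ℝ} (hf : Measurable f) :
    Measurable (ballMean r f) := by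
  have h : StronglyMeasurable fun x : Plane => ∫ y in Metric.ball (0 : Plane) r, f (x + y) :=
    StronglyMeasurable.integral_prod_right
      (f := fun x y => f (x + y)) (hf.comp measurable_add).stronglyMeasurable
  exact h.measurable.const_mul _

lemma volume_real_ball {r : ℝ} (hr : 0 ≤ r) (x : Plane) :
    volume.real (Metric.ball x r) = Real.pi * r ^ 2 := by
  simp [Measure.real, EuclideanSpace.volume_ball_fin_two, Real.pi_pos.le, hr, mul_comm]

lemma abs_ballMean_le {r M : ℝ} (hr : 0 < r) {f : Plane → ℝ} (hf : ∀ x, |f x| ≤ M) (x : Plane) :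
    |ballMean r f x| ≤ M := by
  have h := norm_setIntegral_le_of_norm_le_const (μ := volume) (s := Metric.ball (0 : Plane) r)
    (f := fun y => f (x + y)) (C := M) measure_ball_lt_top (fun y _ => hf _)
  rw [volume_real_ball hr.le, Real.norm_eq_abs] at h
  have hp : 0 < Real.pi * r ^ 2 := by have := Real.pi_pos; positivity
  rw [ballMean, abs_mul, abs_of_pos (inv_pos.2 hp), inv_mul_le_iff₀ hp]
  linarith

/-- Fubini on a product of two balls. It lets the iterated means inherit the decay of the ball means
of `f`. -/
lemma ballMean_comm {r R M : ℝ} {f : Plane → ℝ} (hfm : Measurable f) (hf : ∀ x, |f x| ≤ M) :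
    ballMean R (ballMean r f) = ballMean r (ballMean R f) := by
  ext x
  simp only [ballMean, integral_const_mul]
  rw [integral_integral_swap]
  · simp only [add_right_comm]
    ring
  · have hm : Measurable (Function.uncurry fun y z : Plane => f (x + y + z)) :=
      hfm.comp ((measurable_const.add measurable_fst).add measurable_snd)
    rw [Measure.prod_restrict]
    refine Measure.integrableOn_of_bounded (M := M) ?_ hm.aestronglyMeasurable
      (Eventually.of_forall fun p => hf _)
    rw [Measure.prod_prod]
    exact (ENNReal.mul_lt_top measure_ball_lt_top measure_ball_lt_top).ne

lemma integrable_mul_comp_sub {f g : Plane → ℝ} (hf : Integrable f) (hg : Integrable g) :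
    Integrable (fun p : Plane × Plane => f p.1 * g (p.1 - p.2)) (volume.prod volume) := by
  have h := (hf.convolution_integrand (ContinuousLinearMap.mul ℝ ℝ) hg.comp_neg).swap
  refine h.congr (Eventually.of_forall fun p => ?_)
  simp

lemma ballMean_eq_integral (r : ℝ) (f : Plane → ℝ) (x : Plane) :
    ballMean r f x = (Real.pi * r ^ 2)⁻¹ *
      ∫ y, (Metric.ball (0 : Plane) r).indicator 1 (x - y) * f y := by
  rw [ballMean, ← integral_indicator measurableSet_ball, ← integral_sub_right_eq_self _ x]
  congr 2 with y
  by_cases hy : y ∈ Metric.ball x r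
  · rw [mem_ball_iff_norm] at hy
    have h2 : ‖x - y‖ < r := by rwa [norm_sub_rev]
    simp [indicator, hy, h2]
  · rw [mem_ball_iff_norm] at hy
    have h2 : ¬ ‖x - y‖ < r := by rwa [norm_sub_rev]
    simp [indicator, hy, h2]

lemma indicator_ball_sub_comm (r : ℝ) (x y : Plane) :
    (Metric.ball (0 : Plane) r).indicator (1 : Plane → ℝ) (x - y)
      = (Metric.ball (0 : Plane) r).indicator 1 (y - x) := by
  simp [indicator, norm_sub_rev]

lemma integrable_indicator_ball (r : ℝ) :
    Integrable ((Metric.ball (0 : Plane) r).indicator (1 : Plane → ℝ)) :=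
  (integrable_indicator_iff measurableSet_ball).2 (integrableOn_const measure_ball_lt_top.ne)

lemma integrable_ballMean (r : ℝ) {φ : Plane → ℝ} (hφ : Integrable φ) :
    Integrable (ballMean r φ) := by
  have h := (integrable_mul_comp_sub hφ (integrable_indicator_ball r)).integral_prod_right
  refine (h.const_mul (Real.pi * r ^ 2)⁻¹).congr (Eventually.of_forall fun x => ?_)
  simp only [ballMean_eq_integral]
  congr 2 with y
  rw [indicator_ball_sub_comm, mul_comm]

/-- Averaging is self-adjoint because the ball is symmetric about its centre. -/
lemma integral_ballMean_mul {r M : ℝ} {f φ : Plane → ℝ} (hfm : Measurable f)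
    (hf : ∀ x, |f x| ≤ M) (hφ : Integrable φ) :
    ∫ x, ballMean r f x * φ x = ∫ y, f y * ballMean r φ y := by
  simp only [ballMean_eq_integral, mul_left_comm _ (_)⁻¹ _, mul_assoc, integral_const_mul]
  congr 1
  simp only [← integral_mul_const, ← integral_const_mul]
  rw [integral_integral_swap]
  · congr 1 with y
    congr 1 with x
    rw [indicator_ball_sub_comm]; ring
  · refine ((integrable_mul_comp_sub hφ (integrable_indicator_ball r)).mul_bdd (c := M)
      (hfm.comp measurable_snd).aestronglyMeasurable
      (Eventually.of_forall fun p => hf p.2)).congr (Eventually.of_forall fun p => ?_)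
    simp only [Function.uncurry, Function.comp]
    ring

/-! ### The field of a bounded charge density, each charge being screened -/

/-- The convolution of the density `f` with the screened kernel. -/
noncomputable def kernelField (r : ℝ) (f : Plane → ℝ) (x : Plane) : Plane :=
  ∫ y, f y • screenedKernel r (x - y)

lemma integrable_smul_screenedKernel {r M : ℝ} (hr : 0 < r) {f : Plane → ℝ} (hfm : Measurable f)
    (hf : ∀ x, |f x| ≤ M) (x : Plane) :
    Integrable fun y => f y • screenedKernel r (x - y) :=
  ((integrable_screenedKernel hr).comp_sub_left x).bdd_smul M hfm.aestronglyMeasurable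
    (Eventually.of_forall hf)

lemma norm_kernelField_le {r M : ℝ} (hr : 0 < r) {f : Plane → ℝ} (hf : ∀ x, |f x| ≤ M)
    (x : Plane) : ‖kernelField r f x‖ ≤ M * (2 * Real.pi * r) := by
  have hM : 0 ≤ M := (abs_nonneg _).trans (hf 0)
  calc ‖kernelField r f x‖ ≤ ∫ y, M * ‖screenedKernel r (x - y)‖ := by
        refine norm_integral_le_of_norm_le
          (((integrable_screenedKernel hr).comp_sub_left x).norm.const_mul M)
          (Eventually.of_forall fun y => ?_)
        rw [norm_smul]
        gcongr
        exact hf y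
    _ = M * ∫ y, ‖screenedKernel r y‖ := by
        rw [integral_const_mul, integral_sub_left_eq_self fun y => ‖screenedKernel r y‖]
    _ ≤ _ := by gcongr; exact integral_norm_screenedKernel_le hr

lemma stronglyMeasurable_kernelField (r : ℝ) {f : Plane → ℝ} (hf : Measurable f) :
    StronglyMeasurable (kernelField r f) :=
  StronglyMeasurable.integral_prod_right (f := fun x y => f y • screenedKernel r (x - y))
    ((hf.comp measurable_snd).smul
      ((measurable_screenedKernel r).comp (measurable_fst.sub measurable_snd))).stronglyMeasurable

/-- Fubini reduces this to the pairing for one kernel, and self-adjointness moves the mean from `φ`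
to `f`. The difference on the right is what telescopes later. -/
lemma integral_fderiv_kernelField {T : Plane →L[ℝ] Plane} {c : ℝ} (hT : KernelPairing T c)
    {φ : Plane → ℝ} (hφ : ContDiff ℝ ∞ φ) (hφc : HasCompactSupport φ)
    {r M : ℝ} (hr : 0 < r) {f : Plane → ℝ} (hfm : Measurable f) (hf : ∀ x, |f x| ≤ M) :
    ∫ x, fderiv ℝ φ x (T (kernelField r f x))
      = c * (∫ x, f x * φ x) - c * ∫ x, ballMean r f x * φ x := by
  have hcont : Continuous (fderiv ℝ φ) := hφ.continuous_fderiv (by simp)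
  have hint : Integrable (fderiv ℝ φ) :=
    hcont.integrable_of_hasCompactSupport (hφc.fderiv ℝ)
  have hφi : Integrable φ := hφ.continuous.integrable_of_hasCompactSupport hφc
  have h1 : ∀ x, fderiv ℝ φ x (T (kernelField r f x))
      = ∫ y, f y * fderiv ℝ φ x (T (screenedKernel r (x - y))) := by
    intro x
    have := ((fderiv ℝ φ x).comp T).integral_comp_comm
      (integrable_smul_screenedKernel hr hfm hf x)
    rw [kernelField]
    simpa using this.symm
  simp only [h1]
  rw [integral_integral_swap]
  · simp only [integral_const_mul, hT φ hφ hφc r hr]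
    rw [integral_ballMean_mul hfm hf hφi, ← mul_sub, ← integral_sub, ← integral_const_mul]
    · congr 1 with y; ring
    · exact hφi.bdd_mul hfm.aestronglyMeasurable (Eventually.of_forall hf)
    · exact (integrable_ballMean r hφi).bdd_mul (c := M) hfm.aestronglyMeasurable
        (Eventually.of_forall hf)
  · have hdom := (integrable_mul_comp_sub hint.norm (integrable_screenedKernel hr).norm).const_mul
      (M * ‖T‖)
    refine hdom.mono' ?_ (Eventually.of_forall fun p => ?_)
    · have h2 : Measurable fun p : Plane × Plane =>
          fderiv ℝ φ p.1 (T (screenedKernel r (p.1 - p.2))) :=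
        measurable_fderiv_apply hcont measurable_fst (T.continuous.measurable.comp
          ((measurable_screenedKernel r).comp (measurable_fst.sub measurable_snd)))
      exact ((hfm.comp measurable_snd).mul h2).aestronglyMeasurable
    · simp only [Function.uncurry, norm_mul]
      have hM : 0 ≤ M := (abs_nonneg _).trans (hf 0)
      calc ‖f p.2‖ * ‖fderiv ℝ φ p.1 (T (screenedKernel r (p.1 - p.2)))‖
          ≤ M * (‖fderiv ℝ φ p.1‖ * (‖T‖ * ‖screenedKernel r (p.1 - p.2)‖)) := by
            gcongr
            · exact hf p.2
            · exact (ContinuousLinearMap.le_opNorm _ _).trans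
                (by gcongr; exact ContinuousLinearMap.le_opNorm _ _)
        _ = _ := by ring

/-! ### The field of a density with decaying ball means -/

/-- The density `f` averaged over balls of the radii `2, 4, …, 2 ^ k` in succession. -/
noncomputable def iteratedMean (f : Plane → ℝ) : ℕ → Plane → ℝ
  | 0 => f
  | k + 1 => ballMean (2 ^ (k + 1)) (iteratedMean f k)

section IteratedMean

variable {f : Plane → ℝ} {M D ε : ℝ}

lemma measurable_iteratedMean (hfm : Measurable f) (k : ℕ) :
    Measurable (iteratedMean f k) := by
  induction k with
  | zero => exact hfm
  | succ k ih => exact measurable_ballMean _ ih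

lemma abs_iteratedMean_le (hf : ∀ x, |f x| ≤ M) (k : ℕ) (x : Plane) :
    |iteratedMean f k x| ≤ M := by
  induction k generalizing x with
  | zero => exact hf x
  | succ k ih => exact abs_ballMean_le (by positivity) ih x

/-- Averages commute and do not increase the supremum, so the constant `D` is not degraded by
iteration. -/
lemma abs_ballMean_iteratedMean_le (hfm : Measurable f) (hf : ∀ x, |f x| ≤ M)
    (hD : ∀ R : ℝ, 1 < R → ∀ x, |ballMean R f x| ≤ D * R ^ (-(1 + ε))) (k : ℕ) {R : ℝ}
    (hR : 1 < R) (x : Plane) :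
    |ballMean R (iteratedMean f k) x| ≤ D * R ^ (-(1 + ε)) := by
  induction k generalizing x with
  | zero => exact hD R hR x
  | succ k ih =>
    rw [iteratedMean, ballMean_comm (measurable_iteratedMean hfm k) (abs_iteratedMean_le hf k)]
    exact abs_ballMean_le (by positivity) ih x

lemma abs_iteratedMean_succ_le (hfm : Measurable f) (hf : ∀ x, |f x| ≤ M)
    (hD : ∀ R : ℝ, 1 < R → ∀ x, |ballMean R f x| ≤ D * R ^ (-(1 + ε))) (k : ℕ) (x : Plane) :
    |iteratedMean f (k + 1) x| ≤ D * (((2 : ℝ) ^ (k + 1))⁻¹ * ((2 : ℝ) ^ (-ε)) ^ (k + 1)) := by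
  -- The decay is assumed only for `R > 1`, which is why the radii start at `2` and not at `1`.
  have h := abs_ballMean_iteratedMean_le hfm hf hD k (R := 2 ^ (k + 1))
    (one_lt_pow₀ one_lt_two (by omega)) x
  refine h.trans_eq ?_
  rw [neg_add, Real.rpow_add (by positivity), Real.rpow_neg_one, ← Real.rpow_natCast,
    ← Real.rpow_mul (by norm_num), mul_comm _ (-ε), Real.rpow_mul (by norm_num),
    Real.rpow_natCast, Real.rpow_natCast]

lemma iteratedMean_decay_const_nonneg
    (hD : ∀ R : ℝ, 1 < R → ∀ x, |ballMean R f x| ≤ D * R ^ (-(1 + ε))) : 0 ≤ D := by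
  have h := (abs_nonneg _).trans (hD 2 one_lt_two 0)
  exact nonneg_of_mul_nonneg_left h (by positivity)

/-- For `k ≥ 1` the kernel costs a factor of order `2 ^ k`, the density is `O(2 ^ (-(1 + ε) k))`,
and `2 ^ (-ε k)` survives. For `k = 0` only the bound `M` is available, whence `M + D`. -/
lemma norm_kernelField_iteratedMean_le (hfm : Measurable f) (hf : ∀ x, |f x| ≤ M)
    (hD : ∀ R : ℝ, 1 < R → ∀ x, |ballMean R f x| ≤ D * R ^ (-(1 + ε))) (k : ℕ) (x : Plane) :
    ‖kernelField (2 ^ (k + 1)) (iteratedMean f k) x‖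
      ≤ 4 * Real.pi * (M + D) * ((2 : ℝ) ^ (-ε)) ^ k := by
  have hM : 0 ≤ M := (abs_nonneg _).trans (hf 0)
  have hD0 := iteratedMean_decay_const_nonneg hD
  have hpi := Real.pi_pos
  cases k with
  | zero =>
    refine (norm_kernelField_le (by positivity) hf x).trans ?_
    simp only [zero_add, pow_one, pow_zero, mul_one]
    nlinarith [mul_nonneg hpi.le hD0]
  | succ k =>
    refine (norm_kernelField_le (by positivity)
      (abs_iteratedMean_succ_le hfm hf hD k) x).trans ?_
    have h2 : ((2 : ℝ) ^ (k + 1))⁻¹ * 2 ^ (k + 1 + 1) = 2 := by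
      rw [pow_succ 2 (k + 1), inv_mul_cancel_left₀ (by positivity)]
    calc D * (((2 : ℝ) ^ (k + 1))⁻¹ * ((2 : ℝ) ^ (-ε)) ^ (k + 1))
          * (2 * Real.pi * 2 ^ (k + 1 + 1))
        = 2 * Real.pi * D * ((2 : ℝ) ^ (-ε)) ^ (k + 1)
          * (((2 : ℝ) ^ (k + 1))⁻¹ * 2 ^ (k + 1 + 1)) := by ring
      _ = 4 * Real.pi * D * ((2 : ℝ) ^ (-ε)) ^ (k + 1) := by rw [h2]; ring
      _ ≤ _ := by gcongr; linarith

lemma tendsto_integral_iteratedMean_mul (hε : 0 < ε) (hfm : Measurable f)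
    (hf : ∀ x, |f x| ≤ M)
    (hD : ∀ R : ℝ, 1 < R → ∀ x, |ballMean R f x| ≤ D * R ^ (-(1 + ε)))
    {φ : Plane → ℝ} (hφ : Integrable φ) :
    Tendsto (fun k => ∫ x, iteratedMean f k x * φ x) atTop (𝓝 0) := by
  have hD0 := iteratedMean_decay_const_nonneg hD
  have hlt : (2 : ℝ) ^ (-ε) < 1 := Real.rpow_lt_one_of_one_lt_of_neg one_lt_two (by linarith)
  rw [← tendsto_add_atTop_iff_nat 1]
  have hb : ∀ k, ‖∫ x, iteratedMean f (k + 1) x * φ x‖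
      ≤ D * ((2 : ℝ) ^ (-ε)) ^ (k + 1) * ∫ x, ‖φ x‖ := by
    intro k
    rw [← integral_const_mul]
    refine norm_integral_le_of_norm_le (hφ.norm.const_mul _) (Eventually.of_forall fun x => ?_)
    rw [norm_mul]
    gcongr
    refine (abs_iteratedMean_succ_le hfm hf hD k x).trans ?_
    gcongr
    refine mul_le_of_le_one_left (by positivity) ?_
    exact inv_le_one_of_one_le₀ (one_le_pow₀ one_le_two)
  refine squeeze_zero_norm hb ?_
  have h0 := (tendsto_pow_atTop_nhds_zero_of_lt_one (r := (2 : ℝ) ^ (-ε)) (by positivity) hlt)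
  have := ((tendsto_add_atTop_iff_nat 1).2 h0).const_mul D |>.mul_const (∫ x, ‖φ x‖)
  simpa using this

/-- A bounded density whose means over balls of radius `R` are `O(R ^ (-(1 + ε)))` is minus the
divergence of a bounded curl-free field, up to the factor `2π`. -/
lemma exists_bounded_field (hε : 0 < ε) (hfm : Measurable f) (hf : ∀ x, |f x| ≤ M)
    (hD : ∀ R : ℝ, 1 < R → ∀ x, |ballMean R f x| ≤ D * R ^ (-(1 + ε))) :
    ∃ g : Plane → Plane, StronglyMeasurable g ∧ (∃ B, ∀ x, ‖g x‖ ≤ B) ∧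
      ∀ T c, KernelPairing T c → ∀ φ : Plane → ℝ, ContDiff ℝ ∞ φ → HasCompactSupport φ →
        ∫ x, fderiv ℝ φ x (T (g x)) = c * ∫ x, f x * φ x := by
  set ρ : ℝ := (2 : ℝ) ^ (-ε) with hρ
  have hρ0 : 0 ≤ ρ := by positivity
  have hlt : ρ < 1 := Real.rpow_lt_one_of_one_lt_of_neg one_lt_two (by linarith)
  set F : ℕ → Plane → Plane := fun k => kernelField (2 ^ (k + 1)) (iteratedMean f k) with hF
  set A : ℝ := 4 * Real.pi * (M + D) with hA
  have hFb : ∀ k x, ‖F k x‖ ≤ A * ρ ^ k := norm_kernelField_iteratedMean_le hfm hf hD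
  have hsum : Summable fun k => A * ρ ^ k := (summable_geometric_of_lt_one hρ0 hlt).mul_left A
  have hFs : ∀ x, Summable fun k => F k x := fun x =>
    hsum.of_norm_bounded fun k => hFb k x
  have hFm : ∀ k, StronglyMeasurable (F k) := fun k =>
    stronglyMeasurable_kernelField _ (measurable_iteratedMean hfm k)
  refine ⟨fun x => ∑' k, F k x, ?_, ⟨∑' k, A * ρ ^ k, fun x => ?_⟩, ?_⟩
  · refine stronglyMeasurable_of_tendsto (f := fun n x => ∑ k ∈ Finset.range n, F k x) atTop
      (fun n => Finset.stronglyMeasurable_fun_sum _ fun k _ => hFm k) ?_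
    rw [tendsto_pi_nhds]
    exact fun x => (hFs x).hasSum.tendsto_sum_nat
  · exact tsum_of_norm_bounded hsum.hasSum fun k => hFb k x
  · intro T c hT φ hφ hφc
    have hcont : Continuous (fderiv ℝ φ) := hφ.continuous_fderiv (by simp)
    have hint : Integrable (fderiv ℝ φ) :=
      hcont.integrable_of_hasCompactSupport (hφc.fderiv ℝ)
    have hφi : Integrable φ := hφ.continuous.integrable_of_hasCompactSupport hφc
    have hbound : ∀ k x, ‖fderiv ℝ φ x (T (F k x))‖ ≤ ‖fderiv ℝ φ x‖ * ‖T‖ * (A * ρ ^ k) := by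
      intro k x
      rw [mul_assoc]
      refine (ContinuousLinearMap.le_opNorm _ _).trans ?_
      gcongr
      refine (ContinuousLinearMap.le_opNorm _ _).trans ?_
      gcongr
      exact hFb k x
    have hmeas : ∀ k, Measurable fun x => fderiv ℝ φ x (T (F k x)) := fun k =>
      measurable_fderiv_apply hcont measurable_id (T.continuous.measurable.comp (hFm k).measurable)
    have hinti : ∀ k, Integrable fun x => fderiv ℝ φ x (T (F k x)) := fun k =>
      ((hint.norm.mul_const ‖T‖).mul_const (A * ρ ^ k)).mono' (hmeas k).aestronglyMeasurable
        (Eventually.of_forall (hbound k))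
    have hsumnorm : Summable fun k => ∫ x, ‖fderiv ℝ φ x (T (F k x))‖ := by
      refine Summable.of_nonneg_of_le (fun k => integral_nonneg fun x => norm_nonneg _)
        (fun k => ?_) (hsum.mul_left (∫ x, ‖fderiv ℝ φ x‖ * ‖T‖))
      rw [← integral_mul_const]
      exact integral_mono (hinti k).norm
        ((hint.norm.mul_const ‖T‖).mul_const (A * ρ ^ k)) (hbound k)
    have h1 := hasSum_integral_of_summable_integral_norm hinti hsumnorm
    have h2 : ∀ k, ∫ x, fderiv ℝ φ x (T (F k x))
        = c * (∫ x, iteratedMean f k x * φ x) - c * ∫ x, iteratedMean f (k + 1) x * φ x :=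
      fun k => integral_fderiv_kernelField hT hφ hφc (by positivity)
        (measurable_iteratedMean hfm k) (abs_iteratedMean_le hf k)
    simp only [h2] at h1
    have h3 := h1.tendsto_sum_nat
    -- The partial sums telescope to the term of `f` minus the term of the `n`-th iterated mean, and
    -- the latter tends to `0`.
    simp only [Finset.sum_range_sub'] at h3
    have h4 := ((tendsto_integral_iteratedMean_mul hε hfm hf hD hφi).const_mul c).const_sub
      (c * ∫ x, iteratedMean f 0 x * φ x)
    have h5 := tendsto_nhds_unique h3 h4
    rw [mul_zero, sub_zero] at h5
    rw [← iteratedMean.eq_1 f, ← h5]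
    congr 1 with x
    have h6 := (((fderiv ℝ φ x).comp T).hasSum (hFs x).hasSum).tsum_eq
    simpa using h6.symm

end IteratedMean

/-! ### Uniformly separated sets -/

lemma UniformlySeparated.exists_radius {Λ : Set Plane} (h : UniformlySeparated Λ) :
    ∃ r : ℝ, 0 < r ∧ r ≤ 1 / 2 ∧ ∀ p ∈ Λ, ∀ q ∈ Λ, p ≠ q → 2 * r ≤ dist p q := by
  obtain ⟨C, hC, hCd⟩ := einfsep_pos.1 h
  -- `C` may be `⊤`, when `Λ` has at most one point; the minimum with `1` makes it finite and also
  -- yields `r ≤ 1 / 2`.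
  have hC1 : 0 < min C 1 := lt_min hC one_pos
  have htop : min C 1 ≠ ⊤ := ((min_le_right _ _).trans_lt ENNReal.one_lt_top).ne
  have h1 : (min C 1).toReal ≤ 1 := by
    simpa using ENNReal.toReal_mono ENNReal.one_ne_top (min_le_right C 1)
  refine ⟨(min C 1).toReal / 2, half_pos (ENNReal.toReal_pos hC1.ne' htop), by linarith,
    fun p hp q hq hpq => ?_⟩
  have h2 := (min_le_left C 1).trans (hCd p hp q hq hpq)
  rw [edist_dist] at h2
  have h3 := ENNReal.toReal_mono ENNReal.ofReal_ne_top h2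
  rw [ENNReal.toReal_ofReal dist_nonneg] at h3
  linarith

section Separated

variable {Λ : Set Plane} {r : ℝ}

lemma eq_of_mem_ball_of_separated (hsep : ∀ p ∈ Λ, ∀ q ∈ Λ, p ≠ q → 2 * r ≤ dist p q)
    {p q x : Plane} (hp : p ∈ Λ) (hq : q ∈ Λ) (hxp : ‖x - p‖ < r) (hxq : ‖x - q‖ < r) :
    p = q := by
  by_contra h
  have h1 := hsep p hp q hq h
  have h2 := dist_triangle_left p q x
  rw [dist_eq_norm x p, dist_eq_norm x q] at h2
  linarith

/-- A ball of radius `r` holds at most one point of `Λ`, and finitely many such balls cover a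
bounded set. -/
lemma finite_ball_inter_of_separated (hr : 0 < r)
    (hsep : ∀ p ∈ Λ, ∀ q ∈ Λ, p ≠ q → 2 * r ≤ dist p q) (x : Plane) (R : ℝ) :
    (Metric.ball x R ∩ Λ).Finite := by
  obtain ⟨t, ht, hcov⟩ := Metric.totallyBounded_iff.1
    ((isCompact_closedBall x R).totallyBounded.subset Metric.ball_subset_closedBall) r hr
  refine (ht.biUnion (t := fun y => Metric.ball y r ∩ Λ) fun y _ =>
    Set.Subsingleton.finite ?_).subset ?_
  · rintro p ⟨hp, hpΛ⟩ q ⟨hq, hqΛ⟩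
    exact eq_of_mem_ball_of_separated hsep hpΛ hqΛ (mem_ball_iff_norm'.1 hp)
      (mem_ball_iff_norm'.1 hq)
  · rintro p ⟨hp, hpΛ⟩
    obtain ⟨y, hy, hpy⟩ := mem_iUnion₂.1 (hcov hp)
    exact mem_iUnion₂.2 ⟨y, hy, hpy, hpΛ⟩

lemma exists_finset_ball_inter_of_separated (hr : 0 < r)
    (hsep : ∀ p ∈ Λ, ∀ q ∈ Λ, p ≠ q → 2 * r ≤ dist p q) (x : Plane) (R : ℝ) :
    ∃ S : Finset Plane, ∀ p, p ∈ S ↔ ‖p - x‖ < R ∧ p ∈ Λ :=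
  ⟨(finite_ball_inter_of_separated hr hsep x R).toFinset, fun p => by
    simp [dist_eq_norm]⟩

/-- The union of the discs of radius `r` around the points of `Λ`. -/
def discs (Λ : Set Plane) (r : ℝ) : Set Plane := ⋃ p ∈ Λ, Metric.ball p r

lemma isOpen_discs : IsOpen (discs Λ r) := isOpen_biUnion fun _ _ => Metric.isOpen_ball

lemma indicator_discs_eq_sum (hsep : ∀ p ∈ Λ, ∀ q ∈ Λ, p ≠ q → 2 * r ≤ dist p q)
    {S : Finset Plane} {x : Plane} (hS : ∀ p ∈ S, p ∈ Λ) (hx : ∀ p ∈ Λ, ‖x - p‖ < r → p ∈ S) :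
    (discs Λ r).indicator (1 : Plane → ℝ) x
      = ∑ p ∈ S, (Metric.ball (0 : Plane) r).indicator 1 (p - x) := by
  by_cases h : x ∈ discs Λ r
  · obtain ⟨p, hp, hxp⟩ := mem_iUnion₂.1 h
    rw [mem_ball_iff_norm] at hxp
    rw [Finset.sum_eq_single_of_mem p (hx p hp hxp) fun q hq hqp => ?_]
    · rw [indicator_of_mem h, indicator_of_mem]
      · rfl
      · rwa [mem_ball_zero_iff, norm_sub_rev]
    · refine indicator_of_notMem (fun hmem => hqp ?_) _
      rw [mem_ball_zero_iff, norm_sub_rev] at hmem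
      exact eq_of_mem_ball_of_separated hsep (hS q hq) hp hmem hxp
  · rw [indicator_of_notMem h, Finset.sum_eq_zero fun q hq => ?_]
    refine indicator_of_notMem (fun hmem => h ?_) _
    rw [mem_ball_zero_iff, norm_sub_rev] at hmem
    exact mem_iUnion₂.2 ⟨q, hS q hq, mem_ball_iff_norm.2 hmem⟩

/-- The density of the charge obtained by spreading each unit charge at a point of `Λ` over the
disc of radius `r` around it, against the uniform background `m`. -/
noncomputable def smearedDensity (Λ : Set Plane) (r m : ℝ) (x : Plane) : ℝ :=
  (Real.pi * r ^ 2)⁻¹ * (discs Λ r).indicator 1 x - m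

lemma measurable_smearedDensity (m : ℝ) : Measurable (smearedDensity Λ r m) :=
  ((measurable_one.indicator isOpen_discs.measurableSet).const_mul _).sub_const _

lemma abs_smearedDensity_le (m : ℝ) (x : Plane) :
    |smearedDensity Λ r m x| ≤ (Real.pi * r ^ 2)⁻¹ + |m| := by
  have hp : 0 ≤ (Real.pi * r ^ 2)⁻¹ := by have := Real.pi_pos; positivity
  refine (abs_sub _ _).trans ?_
  gcongr
  rw [abs_mul, abs_of_nonneg hp]
  refine mul_le_of_le_one_right hp ?_
  by_cases h : x ∈ discs Λ r <;> simp [h]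

/-- Both sides are the area of the intersection of two discs of radii `r` and `R` with centres `a`
apart. -/
lemma setIntegral_indicator_ball_comm (r R : ℝ) (a : Plane) :
    ∫ y in Metric.ball (0 : Plane) R, (Metric.ball (0 : Plane) r).indicator (1 : Plane → ℝ) (a - y)
      = ∫ y in Metric.ball (0 : Plane) r,
        (Metric.ball (0 : Plane) R).indicator (1 : Plane → ℝ) (a - y) := by
  rw [← integral_indicator measurableSet_ball, ← integral_indicator measurableSet_ball,
    ← integral_sub_left_eq_self _ volume a]
  congr 1 with y
  by_cases h1 : y ∈ Metric.ball (0 : Plane) r <;>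
    by_cases h2 : a - y ∈ Metric.ball (0 : Plane) R <;>
    simp only [indicator, h1, h2, sub_sub_cancel, if_true, if_false, Pi.one_apply]

/-- The deviation of the number of points of `Λ` per unit area from `m`, in balls of radius `R`. -/
noncomputable def countingDeviation (Λ : Set Plane) (m R : ℝ) (x : Plane) : ℝ :=
  (Real.pi * R ^ 2)⁻¹ * ((Metric.ball x R ∩ Λ).ncard : ℝ) - m

/-- Averaging the smeared charge over an `R`-ball is the same as averaging the point count of
`R`-balls over centres in an `r`-ball. The counting bound therefore passes to the density with no
error from discs cut by the boundary. -/
lemma ballMean_smearedDensity (hr : 0 < r)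
    (hsep : ∀ p ∈ Λ, ∀ q ∈ Λ, p ≠ q → 2 * r ≤ dist p q) (m : ℝ) {R : ℝ} (hR : 0 < R)
    (x : Plane) :
    ballMean R (smearedDensity Λ r m) x = ballMean r (countingDeviation Λ m R) x := by
  -- Radius `R + r` captures every disc meeting `B(x, R)` and every point of `B(x + y, R)` with `‖y‖
  -- < r`.
  obtain ⟨S, hS⟩ := exists_finset_ball_inter_of_separated hr hsep x (R + r)
  have h1 : ∀ y ∈ Metric.ball (0 : Plane) R, smearedDensity Λ r m (x + y)
      = (Real.pi * r ^ 2)⁻¹ * (∑ p ∈ S, (Metric.ball (0 : Plane) r).indicator 1 (p - x - y))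
        - m := by
    intro y hy
    rw [mem_ball_zero_iff] at hy
    rw [smearedDensity, indicator_discs_eq_sum hsep (S := S) (fun p hp => ((hS p).1 hp).2)]
    · simp only [sub_sub]
    · intro p hp hxp
      refine (hS p).2 ⟨?_, hp⟩
      have : p - x = y - (x + y - p) := by abel
      rw [this]
      exact (norm_sub_le _ _).trans_lt (by linarith)
  classical
  have h2 : ∀ y ∈ Metric.ball (0 : Plane) r, countingDeviation Λ m R (x + y)
      = (Real.pi * R ^ 2)⁻¹ * (∑ p ∈ S, (Metric.ball (0 : Plane) R).indicator 1 (p - x - y))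
        - m := by
    intro y hy
    rw [mem_ball_zero_iff] at hy
    have hset : Metric.ball (x + y) R ∩ Λ
        = ↑(S.filter fun p => p - x - y ∈ Metric.ball (0 : Plane) R) := by
      ext p
      simp only [mem_inter_iff, mem_ball_iff_norm, Finset.coe_filter, hS, mem_ofPred_eq,
        sub_zero, sub_sub]
      constructor
      · rintro ⟨hp, hpΛ⟩
        refine ⟨⟨?_, hpΛ⟩, hp⟩
        have : p - x = (p - (x + y)) + y := by abel
        rw [this]
        exact (norm_add_le _ _).trans_lt (by linarith)
      · rintro ⟨⟨_, hpΛ⟩, hp⟩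
        exact ⟨hp, hpΛ⟩
    rw [countingDeviation, hset, ncard_coe_finset, Finset.card_filter]
    push_cast
    simp only [indicator, Pi.one_apply]
  have hint : ∀ (s t : ℝ) (a : Plane), IntegrableOn
      (fun y => (Metric.ball (0 : Plane) s).indicator (1 : Plane → ℝ) (a - y))
      (Metric.ball (0 : Plane) t) := fun s t a =>
    ((integrable_indicator_ball s).comp_sub_left a).integrableOn
  rw [ballMean, ballMean, setIntegral_congr_fun measurableSet_ball h1,
    setIntegral_congr_fun measurableSet_ball h2]
  have hc : ∀ t : ℝ, IntegrableOn (fun _ : Plane => m) (Metric.ball (0 : Plane) t) := fun t =>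
    integrableOn_const measure_ball_lt_top.ne
  rw [integral_sub ((integrable_finsetSum S fun p _ => hint r R (p - x)).const_mul _) (hc R),
    integral_sub ((integrable_finsetSum S fun p _ => hint R r (p - x)).const_mul _) (hc r),
    integral_const_mul, integral_const_mul,
    integral_finsetSum S fun p _ => hint r R (p - x),
    integral_finsetSum S fun p _ => hint R r (p - x),
    setIntegral_const, setIntegral_const, volume_real_ball hr.le, volume_real_ball hR.le]
  simp only [setIntegral_indicator_ball_comm r R, smul_eq_mul]
  have hpi := Real.pi_pos
  field_simp

lemma abs_countingDeviation_le {m C ε : ℝ}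
    (hcount : ∀ (x : Plane) (R : ℝ), 1 < R →
      |((Metric.ball x R ∩ Λ).ncard : ℝ) - m * Real.pi * R ^ 2| ≤ C * R ^ (1 - ε))
    {R : ℝ} (hR : 1 < R) (x : Plane) :
    |countingDeviation Λ m R x| ≤ C / Real.pi * R ^ (-(1 + ε)) := by
  have hpi := Real.pi_pos
  have hR0 : 0 < R := by linarith
  have h1 : countingDeviation Λ m R x = (Real.pi * R ^ 2)⁻¹ *
      (((Metric.ball x R ∩ Λ).ncard : ℝ) - m * Real.pi * R ^ 2) := by
    rw [countingDeviation]; field_simp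
  have h2 : R ^ (-(1 + ε)) = (R ^ 2)⁻¹ * R ^ (1 - ε) := by
    rw [← Real.rpow_natCast, ← Real.rpow_neg hR0.le, ← Real.rpow_add hR0]
    congr 1; push_cast; ring
  rw [h1, abs_mul, abs_of_pos (by positivity), h2]
  calc (Real.pi * R ^ 2)⁻¹ * |((Metric.ball x R ∩ Λ).ncard : ℝ) - m * Real.pi * R ^ 2|
      ≤ (Real.pi * R ^ 2)⁻¹ * (C * R ^ (1 - ε)) := by gcongr; exact hcount x R hR
    _ = _ := by rw [mul_inv]; ring

/-! ### The field of the screened point charges -/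

/-- Minus the field of the unit charges at the points of `Λ`, each screened in the disc of
radius `r`. -/
noncomputable def pointField (Λ : Set Plane) (r : ℝ) (x : Plane) : Plane :=
  ∑ᶠ p ∈ Λ, screenedKernel r (x - p)

lemma pointField_eq_sum (hr : 0 < r) {S : Finset Plane} {x : Plane} (hS : ∀ p ∈ S, p ∈ Λ)
    (hx : ∀ p ∈ Λ, ‖x - p‖ < r → p ∈ S) :
    pointField Λ r x = ∑ p ∈ S, screenedKernel r (x - p) := by
  refine finsum_mem_eq_sum_of_subset _ (fun p hp => hx p hp.1 ?_) hS
  by_contra! h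
  exact hp.2 (screenedKernel_eq_zero hr h)

lemma exists_finset_pointField (hr : 0 < r)
    (hsep : ∀ p ∈ Λ, ∀ q ∈ Λ, p ≠ q → 2 * r ≤ dist p q) (ρ : ℝ) :
    ∃ S : Finset Plane, (∀ p, p ∈ S ↔ ‖p‖ < ρ + r ∧ p ∈ Λ) ∧
      ∀ x : Plane, ‖x‖ < ρ → ∀ p ∈ Λ, ‖x - p‖ < r → p ∈ S := by
  obtain ⟨S, hS⟩ := exists_finset_ball_inter_of_separated hr hsep 0 (ρ + r)
  simp only [sub_zero] at hS
  refine ⟨S, hS, fun x hx p hp hxp => (hS p).2 ⟨?_, hp⟩⟩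
  have : p = x - (x - p) := by abel
  rw [this]
  exact (norm_sub_le _ _).trans_lt (by linarith)

lemma locallyIntegrable_pointField (hr : 0 < r)
    (hsep : ∀ p ∈ Λ, ∀ q ∈ Λ, p ≠ q → 2 * r ≤ dist p q) :
    LocallyIntegrable (pointField Λ r) := by
  intro x
  refine ⟨Metric.ball 0 (‖x‖ + 1), Metric.isOpen_ball.mem_nhds (by simp), ?_⟩
  obtain ⟨S, hS, hSx⟩ := exists_finset_pointField hr hsep (‖x‖ + 1)
  have hint : IntegrableOn (fun x => ∑ p ∈ S, screenedKernel r (x - p))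
      (Metric.ball 0 (‖x‖ + 1)) :=
    (integrable_finsetSum S fun p _ => (integrable_screenedKernel hr).comp_sub_right p).integrableOn
  refine hint.congr_fun (fun y hy => ?_) measurableSet_ball
  exact (pointField_eq_sum hr (fun p hp => ((hS p).1 hp).2)
    (hSx y (mem_ball_zero_iff.1 hy))).symm

lemma l2LocOff_pointField (hr : 0 < r)
    (hsep : ∀ p ∈ Λ, ∀ q ∈ Λ, p ≠ q → 2 * r ≤ dist p q) :
    L2LocOff Λ (pointField Λ r) := by
  intro K hK hKΛ
  obtain ⟨ρ, hρ⟩ := hK.isBounded.subset_ball 0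
  obtain ⟨S, hS, hSx⟩ := exists_finset_pointField hr hsep ρ
  have : IsFiniteMeasure (volume.restrict K) := ⟨by simpa using hK.measure_lt_top⟩
  have hmem : MemLp (fun x => ∑ p ∈ S, screenedKernel r (x - p)) 2 (volume.restrict K) := by
    refine memLp_finsetSum S fun p hp => ?_
    have hpK : ∀ x ∈ K, ‖x - p‖ ≠ 0 := by
      intro x hx h
      rw [norm_sub_eq_zero_iff] at h
      exact hKΛ hx (h ▸ ((hS p).1 hp).2)
    have hc : ContinuousOn (fun x => ‖x - p‖⁻¹) K :=
      ContinuousOn.inv₀ (by fun_prop) hpK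
    obtain ⟨B, hB⟩ := hK.exists_bound_of_continuousOn hc
    refine MemLp.of_bound ((measurable_screenedKernel r).comp
      (measurable_id.sub_const p)).aestronglyMeasurable B ?_
    filter_upwards [ae_restrict_mem hK.measurableSet] with x hx
    refine (norm_screenedKernel_le r _).trans ((le_abs_self _).trans (hB x hx))
  refine hmem.ae_eq ?_
  filter_upwards [ae_restrict_mem hK.measurableSet] with x hx
  exact (pointField_eq_sum hr (fun p hp => ((hS p).1 hp).2)
    (hSx x (mem_ball_zero_iff.1 (hρ hx)))).symm

lemma HasCompactSupport.exists_norm_lt {φ : Plane → ℝ} (hφ : HasCompactSupport φ) :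
    ∃ ρ, ∀ x, x ∈ tsupport φ → ‖x‖ < ρ := by
  obtain ⟨ρ, hρ⟩ := (IsCompact.isBounded hφ).subset_ball 0
  exact ⟨ρ, fun x hx => mem_ball_zero_iff.1 (hρ hx)⟩

lemma integrable_fderiv_screenedKernel (hr : 0 < r) (T : Plane →L[ℝ] Plane) {φ : Plane → ℝ}
    (hφ : ContDiff ℝ ∞ φ) (hφc : HasCompactSupport φ) (p : Plane) :
    Integrable fun x => fderiv ℝ φ x (T (screenedKernel r (x - p))) := by
  have hcont : Continuous (fderiv ℝ φ) := hφ.continuous_fderiv (by simp)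
  obtain ⟨B, hB⟩ := (hφc.fderiv ℝ).exists_bound_of_continuous hcont
  refine ((((integrable_screenedKernel hr).comp_sub_right p).norm.const_mul ‖T‖).const_mul
    B).mono' (measurable_fderiv_apply hcont measurable_id (T.continuous.measurable.comp
      ((measurable_screenedKernel r).comp (measurable_id.sub_const p)))).aestronglyMeasurable
    (Eventually.of_forall fun x => ?_)
  refine (ContinuousLinearMap.le_opNorm _ _).trans ?_
  gcongr
  · exact (norm_nonneg _).trans (hB 0)
  · exact hB x
  · exact ContinuousLinearMap.le_opNorm _ _

lemma integral_fderiv_pointField (hr : 0 < r)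
    (hsep : ∀ p ∈ Λ, ∀ q ∈ Λ, p ≠ q → 2 * r ≤ dist p q) {T : Plane →L[ℝ] Plane} {c : ℝ}
    (hT : KernelPairing T c) {φ : Plane → ℝ} (hφ : ContDiff ℝ ∞ φ) (hφc : HasCompactSupport φ) :
    (Integrable fun x => fderiv ℝ φ x (T (pointField Λ r x))) ∧
    ∫ x, fderiv ℝ φ x (T (pointField Λ r x)) = c * ((∑ᶠ p ∈ Λ, φ p) -
      (Real.pi * r ^ 2)⁻¹ * ∫ x, (discs Λ r).indicator 1 x * φ x) := by
  obtain ⟨ρ, hρ⟩ := hφc.exists_norm_lt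
  obtain ⟨S, hS, hSx⟩ := exists_finset_pointField hr hsep ρ
  have hSΛ : ∀ p ∈ S, p ∈ Λ := fun p hp => ((hS p).1 hp).2
  have h1 : (fun x => fderiv ℝ φ x (T (pointField Λ r x)))
      = fun x => ∑ p ∈ S, fderiv ℝ φ x (T (screenedKernel r (x - p))) := by
    ext x
    by_cases hx : x ∈ tsupport φ
    · rw [pointField_eq_sum hr hSΛ (hSx x (hρ x hx)), map_sum, map_sum]
    · have : fderiv ℝ φ x = 0 := by
        by_contra h
        exact hx (support_fderiv_subset ℝ h)
      simp [this]
  have hφi : Integrable φ := hφ.continuous.integrable_of_hasCompactSupport hφc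
  have hint := fun p (_ : p ∈ S) => integrable_fderiv_screenedKernel hr T hφ hφc p
  refine ⟨h1 ▸ integrable_finsetSum S hint, ?_⟩
  have hsum : ∑ᶠ p ∈ Λ, φ p = ∑ p ∈ S, φ p := by
    refine finsum_mem_eq_sum_of_subset _ (fun p hp => (hS p).2 ⟨?_, hp.1⟩) hSΛ
    have := hρ p (subset_tsupport φ hp.2)
    linarith
  have hdisc : ∫ x, (discs Λ r).indicator 1 x * φ x
      = ∑ p ∈ S, ∫ x, (Metric.ball (0 : Plane) r).indicator 1 (p - x) * φ x := by
    rw [← integral_finsetSum]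
    · congr 1 with x
      rw [← Finset.sum_mul]
      by_cases hx : x ∈ tsupport φ
      · rw [indicator_discs_eq_sum hsep hSΛ (hSx x (hρ x hx))]
      · simp [image_eq_zero_of_notMem_tsupport hx]
    · intro p _
      refine hφi.bdd_mul (c := 1) ((measurable_one.indicator measurableSet_ball).comp
        (measurable_const.sub measurable_id)).aestronglyMeasurable
        (Eventually.of_forall fun x => ?_)
      by_cases h : p - x ∈ Metric.ball (0 : Plane) r <;> simp [indicator, h]
  rw [h1, integral_finsetSum S hint, hsum, hdisc, Finset.mul_sum, ← Finset.sum_sub_distrib,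
    Finset.mul_sum]
  refine Finset.sum_congr rfl fun p _ => ?_
  rw [hT φ hφ hφc r hr p, ballMean_eq_integral]

/-! ### An admissible gradient -/

lemma exists_admissibleGradient (hr : 0 < r)
    (hsep : ∀ p ∈ Λ, ∀ q ∈ Λ, p ≠ q → 2 * r ≤ dist p q) {m C ε : ℝ} (hε : 0 < ε)
    (hcount : ∀ (x : Plane) (R : ℝ), 1 < R →
      |((Metric.ball x R ∩ Λ).ncard : ℝ) - m * Real.pi * R ^ 2| ≤ C * R ^ (1 - ε)) :
    ∃ (g : Plane → Plane) (B : ℝ), (∀ x, ‖g x‖ ≤ B) ∧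
      (fun x => -(pointField Λ r x + g x)) ∈ admissibleGradients Λ m := by
  have hD : ∀ R : ℝ, 1 < R → ∀ x,
      |ballMean R (smearedDensity Λ r m) x| ≤ C / Real.pi * R ^ (-(1 + ε)) := fun R hR x => by
    rw [ballMean_smearedDensity hr hsep m (by linarith)]
    exact abs_ballMean_le hr (abs_countingDeviation_le hcount hR) x
  obtain ⟨g, hgm, ⟨B, hB⟩, hg⟩ := exists_bounded_field hε (measurable_smearedDensity m)
    (abs_smearedDensity_le (Λ := Λ) (r := r) m) hD
  refine ⟨g, B, hB, ?_⟩
  have hgl : LocallyIntegrable g := fun x =>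
    ⟨Metric.ball x 1, Metric.ball_mem_nhds x one_pos,
      Measure.integrableOn_of_bounded (M := B) measure_ball_lt_top.ne hgm.aestronglyMeasurable
        (Eventually.of_forall hB)⟩
  -- The smeared charges of the two summands cancel, leaving the points and the background. `T = id`
  -- gives the divergence equation and `T = quarterTurn`, with `c = 0`, the vanishing curl.
  have htest : ∀ T c, KernelPairing T c → ∀ φ : Plane → ℝ, ContDiff ℝ ∞ φ → HasCompactSupport φ →
      ∫ x, fderiv ℝ φ x (T (-(pointField Λ r x + g x)))
        = -c * ((∑ᶠ p ∈ Λ, φ p) - m * ∫ x, φ x) := by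
    intro T c hT φ hφ hφc
    have hcont : Continuous (fderiv ℝ φ) := hφ.continuous_fderiv (by simp)
    have hint : Integrable (fderiv ℝ φ) :=
      hcont.integrable_of_hasCompactSupport (hφc.fderiv ℝ)
    have hφi : Integrable φ := hφ.continuous.integrable_of_hasCompactSupport hφc
    obtain ⟨hpi, hp⟩ := integral_fderiv_pointField hr hsep hT hφ hφc
    have hgi : Integrable fun x => fderiv ℝ φ x (T (g x)) := by
      refine (hint.norm.mul_const (‖T‖ * B)).mono' (measurable_fderiv_apply hcont measurable_id
        (T.continuous.measurable.comp hgm.measurable)).aestronglyMeasurable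
        (Eventually.of_forall fun x => ?_)
      refine (ContinuousLinearMap.le_opNorm _ _).trans ?_
      gcongr
      refine (ContinuousLinearMap.le_opNorm _ _).trans ?_
      gcongr
      exact hB x
    have hdi : Integrable fun x => (discs Λ r).indicator 1 x * φ x := by
      refine hφi.bdd_mul (c := 1) (measurable_one.indicator
        isOpen_discs.measurableSet).aestronglyMeasurable (Eventually.of_forall fun x => ?_)
      by_cases h : x ∈ discs Λ r <;> simp [indicator, h]
    simp only [map_neg, map_add]
    rw [integral_neg, integral_add hpi hgi, hp, hg T c hT φ hφ hφc]
    simp only [smearedDensity, sub_mul, mul_assoc]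
    rw [integral_sub (hdi.const_mul _) (hφi.const_mul _), integral_const_mul,
      integral_const_mul]
    ring
  refine ⟨⟨?_, ?_, ?_⟩, ?_⟩
  · intro K hK hKΛ
    have : IsFiniteMeasure (volume.restrict K) := ⟨by simpa using hK.measure_lt_top⟩
    exact ((l2LocOff_pointField hr hsep K hK hKΛ).add
      (MemLp.of_bound hgm.aestronglyMeasurable B (Eventually.of_forall hB))).neg
  · exact ((locallyIntegrable_pointField hr hsep).add hgl).neg
  · intro φ hφ hφc
    have := htest _ _ kernelPairing_id φ hφ hφc
    simpa only [ContinuousLinearMap.id_apply, neg_neg] using this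
  · intro φ hφ hφc
    have h := htest _ _ kernelPairing_quarterTurn φ hφ hφc
    rw [neg_zero, zero_mul] at h
    refine Eq.trans ?_ h
    congr 1 with x
    rw [quarterTurn_apply, map_sub, map_smul, map_smul, smul_eq_mul, smul_eq_mul]
    ring

end Separated

/-! ### Energy bounds -/

/-- The upper bound follows from the gradient bound: a point with `R - 1 ≤ ‖x‖ < R` is within
distance `1`, radially, of the sphere where the cutoff vanishes. Further in the value is `1`, hence
`max C 1`. -/
lemma IsCutoffFamily.exists_bound {χ : ℝ → Plane → ℝ} (h : IsCutoffFamily χ) :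
    ∃ A : ℝ, ∀ R : ℝ, 1 < R → (∀ x, 0 ≤ χ R x) ∧ (∀ x, χ R x ≤ A) ∧
      (∀ x y, χ R x ≤ χ R y + A * ‖x - y‖) ∧ ∀ x, R ≤ ‖x‖ → χ R x = 0 := by
  obtain ⟨C, hC⟩ := h
  refine ⟨max C 1, fun R hR => ?_⟩
  obtain ⟨hsm, hnn, hder, hone, hzero⟩ := hC R hR
  have hlip : ∀ x y, χ R x ≤ χ R y + max C 1 * ‖x - y‖ := by
    intro x y
    have h1 := Convex.norm_image_sub_le_of_norm_fderiv_le (𝕜 := ℝ) (f := χ R) (s := univ)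
      (C := C) (fun x _ => hsm.differentiable (by simp) x) (fun x _ => hder x) convex_univ
      (mem_univ y) (mem_univ x)
    have h2 : C * ‖x - y‖ ≤ max C 1 * ‖x - y‖ := by gcongr; exact le_max_left _ _
    have h3 := (le_abs_self _).trans h1
    linarith
  have hz : ∀ x, R ≤ ‖x‖ → χ R x = 0 := fun x hx => hzero x (by simpa using hx)
  refine ⟨hnn, fun x => ?_, hlip, hz⟩
  rcases lt_or_ge ‖x‖ (R - 1) with h1 | h1
  · rw [hone x (by simpa using h1)]
    exact le_max_right _ _
  rcases le_or_gt R ‖x‖ with h2 | h2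
  · rw [hz x h2]
    exact zero_le_one.trans (le_max_right _ _)
  have hx0 : 0 < ‖x‖ := by linarith
  have hnorm : ‖(R / ‖x‖) • x‖ = R := by
    rw [norm_smul, Real.norm_of_nonneg (by positivity), div_mul_cancel₀ _ hx0.ne']
  have hdiff : ‖x - (R / ‖x‖) • x‖ = R - ‖x‖ := by
    have h3 : x - (R / ‖x‖) • x = (-((R - ‖x‖) / ‖x‖)) • x := by
      rw [sub_div, div_self hx0.ne', neg_sub, sub_smul, one_smul]
    rw [h3, norm_smul, norm_neg, Real.norm_of_nonneg (by apply div_nonneg <;> linarith),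
      div_mul_cancel₀ _ hx0.ne']
  have h4 := hlip x ((R / ‖x‖) • x)
  rw [hz _ hnorm.ge, zero_add, hdiff] at h4
  refine h4.trans (mul_le_of_le_one_right (zero_le_one.trans (le_max_right _ _)) (by linarith))

lemma integrable_radial_indicator {f : ℝ → ℝ} {S : Set ℝ} (hS : MeasurableSet S)
    (hf : IntegrableOn (fun s => s * f s) S) :
    Integrable fun x : Plane => S.indicator f ‖x‖ := by
  rw [integrable_fun_norm_addHaar volume (f := S.indicator f)]
  have h2 : (fun y : ℝ => y ^ (Module.finrank ℝ Plane - 1) • S.indicator f y)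
      = S.indicator fun y => y * f y := by
    ext y; by_cases hy : y ∈ S <;> simp [hy]
  rw [h2]
  exact ((integrable_indicator_iff hS).2 hf).integrableOn

/-- The `s⁻²` part carries the logarithmic self-energy; the `s⁻¹` part, for the error terms, stays
bounded as `η → 0`. -/
lemma integrable_and_integral_annulus {η r : ℝ} (hη : 0 < η) (hηr : η ≤ r) (a b : ℝ)
    (p : Plane) :
    (Integrable fun x : Plane =>
      (Icc η r).indicator (fun s => a * (s ^ 2)⁻¹ + b * s⁻¹) ‖x - p‖) ∧
    ∫ x : Plane, (Icc η r).indicator (fun s => a * (s ^ 2)⁻¹ + b * s⁻¹) ‖x - p‖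
      = 2 * Real.pi * (a * Real.log (r / η) + b * (r - η)) := by
  have hsub : Icc η r ⊆ Ioi 0 := fun s hs => hη.trans_le hs.1
  have heq : EqOn (fun s : ℝ => s * (a * (s ^ 2)⁻¹ + b * s⁻¹)) (fun s => a * s⁻¹ + b)
      (Icc η r) := by
    intro s hs
    have : s ≠ 0 := (hsub hs).ne'
    simp only
    field_simp
  have hc : ContinuousOn (fun s : ℝ => a * s⁻¹ + b) (Icc η r) :=
    ((continuousOn_inv₀.mono fun s hs => (hsub hs).ne').const_mul a).add continuousOn_const
  have hint : IntegrableOn (fun s : ℝ => a * s⁻¹ + b) (Icc η r) :=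
    hc.integrableOn_compact isCompact_Icc
  refine ⟨(integrable_radial_indicator measurableSet_Icc
    (hint.congr_fun heq.symm measurableSet_Icc)).comp_sub_right p, ?_⟩
  rw [integral_sub_right_eq_self (fun x : Plane =>
    (Icc η r).indicator (fun s => a * (s ^ 2)⁻¹ + b * s⁻¹) ‖x‖) p,
    integral_radial_indicator _ measurableSet_Icc hsub,
    setIntegral_congr_fun measurableSet_Icc heq, integral_Icc_eq_integral_Ioc,
    ← intervalIntegral.integral_of_le hηr, intervalIntegral.integral_add,
    intervalIntegral.integral_const_mul, integral_inv_of_pos hη (hη.trans_le hηr),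
    intervalIntegral.integral_const, smul_eq_mul]
  · ring
  · refine ((continuousOn_inv₀.mono fun s hs => ?_).const_mul a).intervalIntegrable
    rw [uIcc_of_le hηr] at hs
    exact (hsub hs).ne'
  · exact intervalIntegrable_const

section Energy

variable {Λ : Set Plane} {r : ℝ}

lemma norm_pointField_le (hr : 0 < r)
    (hsep : ∀ p ∈ Λ, ∀ q ∈ Λ, p ≠ q → 2 * r ≤ dist p q) {p x : Plane} (hp : p ∈ Λ)
    (hxp : ‖x - p‖ < r) : ‖pointField Λ r x‖ ≤ ‖x - p‖⁻¹ := by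
  rw [pointField_eq_sum hr (S := {p}) (by simpa using hp) fun q hq hxq => by
    simpa using eq_of_mem_ball_of_separated hsep hq hp hxq hxp]
  simpa using norm_screenedKernel_le r (x - p)

lemma pointField_eq_zero (hr : 0 < r) {x : Plane} (hx : ∀ p ∈ Λ, r ≤ ‖x - p‖) :
    pointField Λ r x = 0 := by
  rw [pointField_eq_sum hr (S := ∅) (by simp) fun q hq hxq => by
    linarith [hx q hq]]
  simp

/-- The energy density of `pointField + g` off the discs of radius `η` is controlled by the sum of
the energy densities of the single charges and of lower order terms. -/
lemma energyDensity_le (hr : 0 < r) (hr1 : r ≤ 1 / 2)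
    (hsep : ∀ p ∈ Λ, ∀ q ∈ Λ, p ≠ q → 2 * r ≤ dist p q) {g : Plane → Plane} {B : ℝ}
    (hg : ∀ x, ‖g x‖ ≤ B) {ψ : Plane → ℝ} {A R : ℝ} (hψ0 : ∀ x, 0 ≤ ψ x) (hψA : ∀ x, ψ x ≤ A)
    (hψL : ∀ x y, ψ x ≤ ψ y + A * ‖x - y‖) (hψR : ∀ x, R ≤ ‖x‖ → ψ x = 0)
    {S : Finset Plane} (hS : ∀ p, p ∈ S ↔ ‖p‖ < R + 1 ∧ p ∈ Λ) {η : ℝ} (hη : 0 < η)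
    {x : Plane} (hx : x ∈ (⋃ p ∈ Λ, Metric.ball p η)ᶜ) :
    1 / 2 * (ψ x * ‖-(pointField Λ r x + g x)‖ ^ 2)
      ≤ (Metric.ball (0 : Plane) R).indicator (fun _ => 1 / 2 * A * B ^ 2) x
        + ∑ p ∈ S, (Icc η r).indicator
            (fun s => ψ p / 2 * (s ^ 2)⁻¹ + (A / 2 + A * B) * s⁻¹) ‖x - p‖ := by
  have hA : 0 ≤ A := (hψ0 0).trans (hψA 0)
  have hB : 0 ≤ B := (norm_nonneg _).trans (hg 0)
  have hterm : ∀ p ∈ S, 0 ≤ (Icc η r).indicator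
      (fun s => ψ p / 2 * (s ^ 2)⁻¹ + (A / 2 + A * B) * s⁻¹) ‖x - p‖ := by
    intro p _
    refine indicator_nonneg (fun s hs => ?_) _
    have : 0 < s := hη.trans_le hs.1
    have := hψ0 p
    positivity
  rcases le_or_gt R ‖x‖ with hxR | hxR
  · rw [hψR x hxR, indicator_of_notMem (by simpa using hxR)]
    simpa using Finset.sum_nonneg hterm
  rw [indicator_of_mem (by simpa using hxR), norm_neg]
  by_cases hp : ∃ p ∈ Λ, ‖x - p‖ < r
  · obtain ⟨p, hpΛ, hxp⟩ := hp
    have hpS : p ∈ S := by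
      refine (hS p).2 ⟨?_, hpΛ⟩
      have : p = x - (x - p) := by abel
      rw [this]
      exact (norm_sub_le _ _).trans_lt (by linarith)
    have hηx : η ≤ ‖x - p‖ := by
      by_contra! hlt
      exact hx (mem_iUnion₂.2 ⟨p, hpΛ, mem_ball_iff_norm.2 hlt⟩)
    have hle := Finset.single_le_sum hterm hpS
    rw [indicator_of_mem (show ‖x - p‖ ∈ Icc η r from ⟨hηx, hxp.le⟩)] at hle
    set s := ‖x - p‖ with hs
    have hs0 : 0 < s := hη.trans_le hηx
    have hnorm : ‖pointField Λ r x + g x‖ ≤ s⁻¹ + B :=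
      (norm_add_le _ _).trans (add_le_add (norm_pointField_le hr hsep hpΛ hxp) (hg x))
    have h1 : 1 / 2 * (ψ x * ‖pointField Λ r x + g x‖ ^ 2)
        ≤ 1 / 2 * (ψ x * (s⁻¹ + B) ^ 2) := by
      have := hψ0 x
      gcongr
    -- Freezing the cutoff at `p` costs only `A * s⁻¹` by the Lipschitz bound. Half of this, with
    -- half of the cross term `2 * A * B * s⁻¹`, gives the coefficient `A / 2 + A * B`.
    have h2 : ψ x * (s ^ 2)⁻¹ ≤ ψ p * (s ^ 2)⁻¹ + A * s⁻¹ := by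
      calc ψ x * (s ^ 2)⁻¹ ≤ (ψ p + A * s) * (s ^ 2)⁻¹ := by gcongr; exact hψL x p
        _ = _ := by field_simp
    have h3 : ψ x * (B * s⁻¹) ≤ A * (B * s⁻¹) := by gcongr; exact hψA x
    have h4 : ψ x * B ^ 2 ≤ A * B ^ 2 := by gcongr; exact hψA x
    have h5 : (s⁻¹ + B) ^ 2 = (s ^ 2)⁻¹ + 2 * (B * s⁻¹) + B ^ 2 := by
      rw [← inv_pow]; ring
    rw [h5] at h1
    linarith
  · push Not at hp
    rw [pointField_eq_zero hr hp, zero_add]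
    have h1 : ψ x * ‖g x‖ ^ 2 ≤ A * B ^ 2 := by
      gcongr
      · exact hψA x
      · exact hg x
    have := Finset.sum_nonneg hterm
    linarith

lemma integrable_and_integral_energyMajorant {R η a : ℝ} (hR : 0 < R) (hη : 0 < η)
    (hηr : η ≤ r) (S : Finset Plane) (ψ : Plane → ℝ) (b : ℝ) :
    (Integrable fun x : Plane => (Metric.ball (0 : Plane) R).indicator (fun _ => a) x
        + ∑ p ∈ S, (Icc η r).indicator (fun s => ψ p / 2 * (s ^ 2)⁻¹ + b * s⁻¹) ‖x - p‖) ∧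
    ∫ x : Plane, ((Metric.ball (0 : Plane) R).indicator (fun _ => a) x
        + ∑ p ∈ S, (Icc η r).indicator (fun s => ψ p / 2 * (s ^ 2)⁻¹ + b * s⁻¹) ‖x - p‖)
      = Real.pi * R ^ 2 * a
        + ∑ p ∈ S, (Real.pi * ψ p * Real.log (r / η) + 2 * Real.pi * b * (r - η)) := by
  have h1 : Integrable fun x : Plane => (Metric.ball (0 : Plane) R).indicator (fun _ => a) x :=
    (integrable_indicator_iff measurableSet_ball).2 (integrableOn_const measure_ball_lt_top.ne)
  have h2 := fun p (_ : p ∈ S) => (integrable_and_integral_annulus hη hηr (ψ p / 2) b p).1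
  refine ⟨h1.add (integrable_finsetSum S h2), ?_⟩
  rw [integral_add h1 (integrable_finsetSum S h2), integral_finsetSum S h2,
    integral_indicator measurableSet_ball, setIntegral_const, volume_real_ball hR.le, smul_eq_mul]
  congr 1
  refine Finset.sum_congr rfl fun p _ => ?_
  rw [(integrable_and_integral_annulus hη hηr (ψ p / 2) b p).2]
  ring

/-- The bound is proved for every `η < r`, uniformly, so it survives the upper limit. -/
lemma truncatedEnergy_le (hr : 0 < r) (hr1 : r ≤ 1 / 2)
    (hsep : ∀ p ∈ Λ, ∀ q ∈ Λ, p ≠ q → 2 * r ≤ dist p q) {g : Plane → Plane} {B : ℝ}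
    (hg : ∀ x, ‖g x‖ ≤ B) {ψ : Plane → ℝ} {A R : ℝ} (hR : 0 < R) (hψ0 : ∀ x, 0 ≤ ψ x)
    (hψA : ∀ x, ψ x ≤ A)
    (hψL : ∀ x y, ψ x ≤ ψ y + A * ‖x - y‖) (hψR : ∀ x, R ≤ ‖x‖ → ψ x = 0)
    {S : Finset Plane} (hS : ∀ p, p ∈ S ↔ ‖p‖ < R + 1 ∧ p ∈ Λ) :
    truncatedEnergy Λ (fun x => -(pointField Λ r x + g x)) ψ
      ≤ ((Real.pi * R ^ 2 * (1 / 2 * A * B ^ 2)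
        + S.card * (2 * Real.pi * (A / 2 + A * B)) : ℝ) : EReal) := by
  have hA : 0 ≤ A := (hψ0 0).trans (hψA 0)
  have hB : 0 ≤ B := (norm_nonneg _).trans (hg 0)
  have hpi := Real.pi_pos
  refine limsup_le_of_le (h := ?_)
  filter_upwards [Ioo_mem_nhdsGT hr] with η hη
  obtain ⟨hη0, hηr⟩ := hη
  obtain ⟨hint, hval⟩ := integrable_and_integral_energyMajorant (a := 1 / 2 * A * B ^ 2) hR hη0
    hηr.le S ψ (A / 2 + A * B)
  set G : Plane → ℝ := fun x => (Metric.ball (0 : Plane) R).indicator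
    (fun _ => 1 / 2 * A * B ^ 2) x + ∑ p ∈ S, (Icc η r).indicator
      (fun s => ψ p / 2 * (s ^ 2)⁻¹ + (A / 2 + A * B) * s⁻¹) ‖x - p‖ with hG
  have hG0 : ∀ x, 0 ≤ G x := by
    intro x
    refine add_nonneg (indicator_nonneg (fun _ _ => by positivity) _)
      (Finset.sum_nonneg fun p _ => indicator_nonneg (fun s hs => ?_) _)
    have : 0 < s := hη0.trans_le hs.1
    have := hψ0 p
    positivity
  have hlint : ∫⁻ x in (⋃ p ∈ Λ, Metric.ball p η)ᶜ,
      ENNReal.ofReal (1 / 2 * (ψ x * ‖-(pointField Λ r x + g x)‖ ^ 2))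
      ≤ ENNReal.ofReal (∫ x, G x) := by
    rw [ofReal_integral_eq_lintegral_ofReal hint (Eventually.of_forall hG0)]
    refine le_trans (setLIntegral_mono' ?_ fun x hx => ENNReal.ofReal_le_ofReal
      (energyDensity_le hr hr1 hsep hg hψ0 hψA hψL hψR hS hη0 hx)) (setLIntegral_le_lintegral _ _)
    exact (isOpen_biUnion fun _ _ => Metric.isOpen_ball).measurableSet.compl
  have hsum : ∑ᶠ p ∈ Λ, ψ p = ∑ p ∈ S, ψ p := by
    refine finsum_mem_eq_sum_of_subset _ (fun p hp => (hS p).2 ⟨?_, hp.1⟩)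
      fun p hp => ((hS p).1 hp).2
    by_contra! h
    exact hp.2 (hψR p (by linarith))
  have hlint' : ((∫⁻ x in (⋃ p ∈ Λ, Metric.ball p η)ᶜ,
      ENNReal.ofReal (1 / 2 * (ψ x * ‖-(pointField Λ r x + g x)‖ ^ 2)) : ℝ≥0∞) : EReal)
      ≤ ((∫ x, G x : ℝ) : EReal) := by
    refine (EReal.coe_ennreal_le_coe_ennreal_iff.2 hlint).trans_eq ?_
    rw [EReal.coe_ennreal_ofReal, max_eq_left (integral_nonneg hG0)]
  refine (add_le_add_left hlint' _).trans ?_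
  rw [← EReal.coe_add, EReal.coe_le_coe_iff, hval, hsum, Finset.mul_sum, add_assoc,
    ← Finset.sum_add_distrib, ← nsmul_eq_mul, ← Finset.sum_const]
  gcongr with p _
  -- The two `log η` terms cancel; the remaining `π * ψ p * log r` is nonpositive as `r < 1`.
  rw [Real.log_div hr.ne' hη0.ne']
  have h1 : Real.pi * ψ p * Real.log r ≤ 0 :=
    mul_nonpos_of_nonneg_of_nonpos (mul_nonneg hpi.le (hψ0 p))
      (Real.log_nonpos hr.le (by linarith))
  have h2 : 2 * Real.pi * (A / 2 + A * B) * (r - η) ≤ 2 * Real.pi * (A / 2 + A * B) :=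
    mul_le_of_le_one_right (by positivity) (by linarith)
  linarith

end Energy

theorem theorem2 (Λ : Set Plane) (hsep : UniformlySeparated Λ)
    (m : ℝ) (hm : 0 ≤ m) (C ε : ℝ) (hε : ε ∈ Set.Ioo (0 : ℝ) 1)
    (hcount : ∀ (x : Plane) (R : ℝ), 1 < R →
      |((Metric.ball x R ∩ Λ).ncard : ℝ) - m * Real.pi * R ^ 2| ≤ C * R ^ (1 - ε))
    (χ : ℝ → Plane → ℝ) (hχ : IsCutoffFamily χ) :
    renormalizedEnergy χ Λ m < ⊤ := by
  obtain ⟨r, hr, hr1, hd⟩ := hsep.exists_radius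
  obtain ⟨g, B, hB, hadm⟩ := exists_admissibleGradient hr hd hε.1 hcount
  obtain ⟨A, hχA⟩ := hχ.exists_bound
  have hA : 0 ≤ A := ((hχA 2 one_lt_two).1 0).trans ((hχA 2 one_lt_two).2.1 0)
  have hB0 : 0 ≤ B := (norm_nonneg _).trans (hB 0)
  have hpi := Real.pi_pos
  -- The energy of `g` per unit area, plus the cost per point times the bound `4 * (m * π + |C|) * R
  -- ^ 2` on the number of points, divided by `π * R ^ 2`.
  set E : ℝ := 1 / 2 * A * B ^ 2
    + 4 * (m * Real.pi + |C|) * (2 * Real.pi * (A / 2 + A * B)) / Real.pi with hE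
  suffices h : fieldEnergy χ Λ (fun x => -(pointField Λ r x + g x)) ≤ (E : EReal) from
    (iInf₂_le_of_le _ hadm h).trans_lt (EReal.coe_lt_top E)
  refine limsup_le_of_le (h := ?_)
  filter_upwards [eventually_gt_atTop 1] with R hR
  obtain ⟨h0, hle, hL, hz⟩ := hχA R hR
  have hR0 : 0 < R := by linarith
  obtain ⟨S, hS⟩ := exists_finset_ball_inter_of_separated hr hd 0 (R + 1)
  have hcard : (S.card : ℝ) ≤ 4 * (m * Real.pi + |C|) * R ^ 2 := by
    have h1 : Metric.ball 0 (R + 1) ∩ Λ = ↑S := by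
      ext p
      simp [hS]
    have h2 := (le_abs_self _).trans (hcount 0 (R + 1) (by linarith))
    rw [h1, ncard_coe_finset] at h2
    -- Only the order `R ^ 2` of the count matters here; the finer exponent has already served to
    -- construct `g`.
    have h3 : (R + 1) ^ (1 - ε) ≤ (R + 1) ^ 2 := by
      rw [← Real.rpow_natCast (R + 1) 2]
      exact Real.rpow_le_rpow_of_exponent_le (by linarith) (by push_cast; linarith [hε.1])
    have h4 : C * (R + 1) ^ (1 - ε) ≤ |C| * (R + 1) ^ 2 := by
      gcongr
      exact le_abs_self C
    have h5 : (R + 1) ^ 2 ≤ 4 * R ^ 2 := by nlinarith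
    calc (S.card : ℝ) ≤ (m * Real.pi + |C|) * (R + 1) ^ 2 := by linarith
      _ ≤ (m * Real.pi + |C|) * (4 * R ^ 2) := by gcongr
      _ = _ := by ring
  have ht := truncatedEnergy_le hr hr1 hd hB hR0 h0 hle hL hz (S := S) (by simpa using hS)
  have hvol : 0 < Real.pi * R ^ 2 := by positivity
  rw [volume_real_ball hR0.le]
  refine (EReal.div_le_div_right_of_nonneg (EReal.coe_nonneg.2 hvol.le) ht).trans ?_
  rw [← EReal.coe_div, EReal.coe_le_coe_iff, div_le_iff₀ hvol]
  have h6 : E * (Real.pi * R ^ 2) = Real.pi * R ^ 2 * (1 / 2 * A * B ^ 2)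
      + 4 * (m * Real.pi + |C|) * R ^ 2 * (2 * Real.pi * (A / 2 + A * B)) := by
    rw [hE]; field_simp
  rw [h6]
  gcongr
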